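/- Let $M$ be a smooth (Hausdorff) $m$-dimensional manifold, let $\mathbf{T}M=TM\oplus T^*M$ with the neutral metric $g((X,\alpha),(Y,\mu))=\alpha(Y)+\mu(X)$ and the Courant bracket $$[(X,\alpha),(Y,\mu)]=\big([X,Y],\,L_X\mu-L_Y\alpha+\tfrac12 d(\alpha(Y)-\mu(X))\big).$$ A generalized Riemannian metric $G$ on $M$ is given by a smooth endomorphism $\phi$ of $\mathbf{T}M$ with $\phi^2=\mathrm{Id}$ and $g(\phi\mathcal X,\phi\mathcal Y)=g(\mathcal X,\mathcal Y)$ such that $G(\mathcal X,\mathcal Y)=g(\phi\mathcal X,\mathcal Y)$ is positive definite. It is equivalent to the pair $(\gamma,\psi)$ of a Riemannian metric $\gamma$ and a $2$-form $\psi$ on $M$ for which the $\pm1$-eigenbundles of $\phi$ are $V_\pm=\{(X,\flat_{\psi\pm\gamma}X) : X\in TM\}$, where $\flat_{\psi\pm\gamma}X=\psi(X,\cdot)\pm\gamma(X,\cdot)$. Let $D$ be the Levi-Civita connection of $\gamma$ and let $\sharp_\gamma:T^*M\to TM$ be the inverse of $X\mapsto\gamma(X,\cdot)$. The canonical big connection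 $\nabla$ of $G$ is the connection on $\mathbf{T}M$ defined by $$\nabla_X(Y,\flat_{\psi\pm\gamma}Y)=(D^\pm_XY,\flat_{\psi\pm\gamma}D^\pm_XY),\qquad D^\pm_XY=D_XY\pm\tfrac12\sharp_\gamma\big(d\psi(X,Y,\cdot)\big).$$ Let $\Psi$ be a smooth endomorphism of $\mathbf{T}M$ such that $(G,\Psi)$ is an almost generalized para-Hermitian structure, i.e. $\Psi^2=\mathrm{Id}$, $g(\mathcal X,\Psi\mathcal Y)+g(\Psi\mathcal X,\mathcal Y)=0$ and $G(\Psi\mathcal X,\Psi\mathcal Y)=G(\mathcal X,\mathcal Y)$. Then $\Psi(X,\flat_{\psi+\gamma}X)=(FX,\flat_{\psi-\gamma}FX)$ for a unique $\gamma$-isometry $F$ of $TM$. The structure $(G,\Psi)$ is called parallel if $\Psi$ is integrable, i.e. $$[\Psi\mathcal X,\Psi\mathcal Y]-\Psi[\mathcal X,\Psi\mathcal Y]-\Psi[\Psi\mathcal X,\mathcal Y]+\Psi^2[\mathcal X,\mathcal Y]=0$$ for all smooth sections $\mathcal X,\mathcal Y$ of $\mathbf{T}M$, and $\Psi$ commutes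 with $\nabla$, i.e. $\nabla_X(\Psi\mathcal Y)=\Psi(\nabla_X\mathcal Y)$ for all smooth vector fields $X$ and smooth sections $\mathcal Y$ of $\mathbf{T}M$. **Proposition 3.3.** The almost generalized para-Hermitian structure $(G,\Psi)$ is parallel if and only if $d\psi=0$ and $F$ is parallel with respect to the Levi-Civita connection $D$ of $\gamma$, i.e. $D_X(FY)=F(D_XY)$ for all smooth vector fields $X,Y$. -/

import Mathlib

open Bundle
open scoped Manifold ContDiff

noncomputable section

namespace GeneralizedGeometry

section Basic

variable (E : Type*) [NormedAddCommGroup E] [NormedSpace ℝ E]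
  {M : Type*} [TopologicalSpace M] [ChartedSpace E M]

/-- The tangent space `T_xM` of a boundaryless manifold modelled on `E`. -/
abbrev Tg (x : M) : Type _ := TangentSpace 𝓘(ℝ, E) x

/-- The cotangent space `T*_xM`. -/
abbrev Cotg (x : M) : Type _ := Tg E x →L[ℝ] ℝ

/-- The fibre `T_xM ⊕ T*_xM` of the big tangent bundle. -/
abbrev BigTg (x : M) : Type _ := Tg E x × Cotg E x

variable {E}

/-- The neutral metric `g((X,α),(Y,μ)) = α(Y) + μ(X)`. -/
def neutral {x : M} (u v : BigTg E x) : ℝ := u.2 v.1 + v.2 u.1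

variable [IsManifold 𝓘(ℝ, E) ∞ M]

/-- `X` is a smooth vector field. -/
def SmoothField (X : Π x : M, Tg E x) : Prop :=
  ContMDiff 𝓘(ℝ, E) (𝓘(ℝ, E).prod 𝓘(ℝ, E)) ∞ (fun x => TotalSpace.mk' E x (X x))

/-- `𝒳` is a smooth section of the vector bundle `TM ⊕ T*M`. -/
def SmoothBigField (𝒳 : Π x : M, BigTg E x) : Prop :=
  ContMDiff 𝓘(ℝ, E) (𝓘(ℝ, E).prod 𝓘(ℝ, E × (E →L[ℝ] ℝ))) ∞
    (fun x => TotalSpace.mk' (E × (E →L[ℝ] ℝ)) x (𝒳 x))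

/-- `A` is a smooth endomorphism of the vector bundle `TM ⊕ T*M`, i.e. a smooth section of the
corresponding bundle of homomorphisms. -/
def SmoothBigEnd (A : Π x : M, BigTg E x →L[ℝ] BigTg E x) : Prop :=
  ContMDiff 𝓘(ℝ, E)
    (𝓘(ℝ, E).prod 𝓘(ℝ, (E × (E →L[ℝ] ℝ)) →L[ℝ] (E × (E →L[ℝ] ℝ)))) ∞
    (fun x => TotalSpace.mk' ((E × (E →L[ℝ] ℝ)) →L[ℝ] (E × (E →L[ℝ] ℝ))) x (A x))

end Basic

section Calculus

variable {E : Type*} [NormedAddCommGroup E] [NormedSpace ℝ E] [FiniteDimensional ℝ E]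
  {M : Type*} [TopologicalSpace M] [ChartedSpace E M] [IsManifold 𝓘(ℝ, E) ∞ M]

/-- The derivative `X(f)` at the point `x` of a function `f` along a vector field `X`. -/
def dirDeriv (X : Π x : M, Tg E x) (f : M → ℝ) (x : M) : ℝ :=
  mvfderiv 𝓘(ℝ, E) f x (X x)

/-- The Lie bracket of vector fields. -/
def lie (X Y : Π x : M, Tg E x) : Π x : M, Tg E x :=
  VectorField.mlieBracket 𝓘(ℝ, E) X Y

open Classical in
/-- The covector at `x` defined by an operation `Φ` on vector fields that is tensorial
(`C^∞`-linear) at `x`; it sends `Z_x` to `Φ Z`. (All operations used below are tensorial when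
the fields they involve are differentiable; the value is `0` by convention otherwise.) -/
def covector (Φ : (Π y : M, Tg E y) → ℝ) (x : M) : Cotg E x :=
  if h : TensorialAt 𝓘(ℝ, E) E Φ x then TensorialAt.mkHom Φ x h else 0

theorem covector_apply {Φ : (Π y : M, Tg E y) → ℝ} {x : M}
    (h : TensorialAt 𝓘(ℝ, E) E Φ x) {Z : Π y : M, Tg E y}
    (hZ : MDiffAt (fun y => TotalSpace.mk' E y (Z y)) x) : covector Φ x (Z x) = Φ Z := by
  rw [covector, dif_pos h]
  exact TensorialAt.mkHom_apply h hZ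

/-- The Lie derivative of a 1-form, `(L_X μ)(Z) = X(μ(Z)) - μ([X,Z])`. -/
def lieDerivForm (X : Π x : M, Tg E x) (μ : Π x : M, Cotg E x) (x : M) : Cotg E x :=
  covector (fun Z => dirDeriv X (fun y => μ y (Z y)) x - μ x (lie X Z x)) x

/-- The Courant bracket
`[(X,α),(Y,μ)] = ([X,Y], L_X μ - L_Y α + (1/2) d(α(Y) - μ(X)))`. -/
def courant (𝒳 𝒴 : Π x : M, BigTg E x) (x : M) : BigTg E x :=
  (lie (fun y => (𝒳 y).1) (fun y => (𝒴 y).1) x,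
    lieDerivForm (fun y => (𝒳 y).1) (fun y => (𝒴 y).2) x
      - lieDerivForm (fun y => (𝒴 y).1) (fun y => (𝒳 y).2) x
      + (1 / 2 : ℝ) • mvfderiv 𝓘(ℝ, E) (fun y => (𝒳 y).2 (𝒴 y).1 - (𝒴 y).2 (𝒳 y).1) x)

/-- The Courant-Nijenhuis torsion
`[Ψ𝒳,Ψ𝒴] - Ψ[𝒳,Ψ𝒴] - Ψ[Ψ𝒳,𝒴] + Ψ²[𝒳,𝒴]` of an endomorphism `Ψ` of `TM ⊕ T*M`. -/
def nijenhuis (Ψ : Π x : M, BigTg E x →L[ℝ] BigTg E x) (𝒳 𝒴 : Π x : M, BigTg E x)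
    (x : M) : BigTg E x :=
  courant (fun y => Ψ y (𝒳 y)) (fun y => Ψ y (𝒴 y)) x
    - Ψ x (courant 𝒳 (fun y => Ψ y (𝒴 y)) x)
    - Ψ x (courant (fun y => Ψ y (𝒳 y)) 𝒴 x)
    + Ψ x (Ψ x (courant 𝒳 𝒴 x))

/-- The exterior derivative of a 2-form `ψ`, evaluated on vector fields at the point `x`. -/
def dTwoForm (ψ : Π x : M, Tg E x →L[ℝ] Cotg E x) (X Y Z : Π x : M, Tg E x) (x : M) : ℝ :=
  dirDeriv X (fun y => ψ y (Y y) (Z y)) x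
    - dirDeriv Y (fun y => ψ y (X y) (Z y)) x
    + dirDeriv Z (fun y => ψ y (X y) (Y y)) x
    - ψ x (lie X Y x) (Z x) + ψ x (lie X Z x) (Y x) - ψ x (lie Y Z x) (X x)

/-- The right-hand side of the Koszul formula for `2γ(D_X Y, Z)`. -/
def koszul (γ : Π x : M, Tg E x →L[ℝ] Cotg E x) (X Y Z : Π x : M, Tg E x) (x : M) : ℝ :=
  dirDeriv X (fun y => γ y (Y y) (Z y)) x
    + dirDeriv Y (fun y => γ y (X y) (Z y)) x
    - dirDeriv Z (fun y => γ y (X y) (Y y)) x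
    + γ x (lie X Y x) (Z x) - γ x (lie X Z x) (Y x) - γ x (lie Y Z x) (X x)

/-- The Levi-Civita connection `D_X Y` of the metric `γ`, given by the Koszul formula; the
metric is written as the map `♭_γ : TM → T*M`, whose inverse is `♯_γ`. -/
def leviCivita (γ : Π x : M, Tg E x →L[ℝ] Cotg E x) (X Y : Π x : M, Tg E x) (x : M) :
    Tg E x :=
  (γ x).inverse ((1 / 2 : ℝ) • covector (fun Z => koszul γ X Y Z x) x)

/-- The connection `D_X Y + (s/2) ♯_γ (i(Y) i(X) dψ)`. For `s = 1` and `s = -1` these are the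
`γ`-metric connections `D^±` with torsion `γ(T(X,Y),Z) = ± dψ(X,Y,Z)`. -/
def torsionConn (s : ℝ) (γ ψ : Π x : M, Tg E x →L[ℝ] Cotg E x) (X Y : Π x : M, Tg E x)
    (x : M) : Tg E x :=
  leviCivita γ X Y x + (s / 2) • (γ x).inverse (covector (fun Z => dTwoForm ψ X Y Z x) x)

theorem covector_zero (x : M) : covector (E := E) (fun _ => 0) x = 0 := by
  have h : TensorialAt 𝓘(ℝ, E) E (fun _ : (Π y : M, Tg E y) => (0 : ℝ)) x := by
    constructor <;> intros <;> simp
  rw [covector, dif_pos h]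
  ext v
  rfl

theorem torsionConn_zero (s : ℝ) (γ ψ : Π x : M, Tg E x →L[ℝ] Cotg E x)
    (X : Π x : M, Tg E x) (x : M) : torsionConn s γ ψ X (fun _ => 0) x = 0 := by
  have hl : ∀ Z : Π x : M, Tg E x, lie (fun _ => 0) Z x = 0 := fun Z => by
    have := congrFun (VectorField.mlieBracket_zero_left (I := 𝓘(ℝ, E)) (W := Z)) x
    exact this
  have hr : lie X (fun _ => 0) x = 0 := by
    have := congrFun (VectorField.mlieBracket_zero_right (I := 𝓘(ℝ, E)) (W := X)) x
    exact this
  have h0 : ∀ Z : Π x : M, Tg E x, dirDeriv Z (fun _ => (0 : ℝ)) x = 0 := fun Z => by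
    have : mvfderiv 𝓘(ℝ, E) (fun _ : M => (0 : ℝ)) x = 0 := by
      simp [mvfderiv, mfderiv_const]
    rw [dirDeriv, this]
    rfl
  have h0' : ∀ f : M → ℝ, dirDeriv (E := E) (fun _ => 0) f x = 0 := fun f => by
    rw [dirDeriv, map_zero]
  have hk : (fun Z => koszul γ X (fun _ => 0) Z x) = fun _ => 0 := by
    funext Z
    simp [koszul, hl, hr, h0, h0']
  have hd : (fun Z => dTwoForm ψ X (fun _ => 0) Z x) = fun _ => 0 := by
    funext Z
    simp [dTwoForm, hl, hr, h0, h0']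
  rw [torsionConn, leviCivita, hk, hd, covector_zero]
  simp

end Calculus

section Structures

variable (E : Type*) [NormedAddCommGroup E] [NormedSpace ℝ E]
  (M : Type*) [TopologicalSpace M] [ChartedSpace E M] [IsManifold 𝓘(ℝ, E) ∞ M]

/-- A generalized Riemannian metric on `M`: a smooth endomorphism `φ` of `TM ⊕ T*M` with
`φ² = Id` that preserves the neutral metric `g` and for which `G(u,v) = g(φu,v)` is positive
definite. The subbundles `V_±` are the `±1`-eigenbundles of `φ`. -/
structure GenRiemannian where
  φ : Π x : M, BigTg E x →L[ℝ] BigTg E x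
  smooth : SmoothBigEnd φ
  φ_sq : ∀ (x : M) (u : BigTg E x), φ x (φ x u) = u
  φ_neutral : ∀ (x : M) (u v : BigTg E x), neutral (φ x u) (φ x v) = neutral u v
  pos : ∀ (x : M) (u : BigTg E x), u ≠ 0 → 0 < neutral (φ x u) u

variable {E M}

namespace GenRiemannian

variable (G : GenRiemannian E M)

/-- The positive definite metric `G(u,v) = g(φu,v)` on `TM ⊕ T*M`. -/
def metric (x : M) (u v : BigTg E x) : ℝ := neutral (G.φ x u) v

/-- The map `α ↦ pr_{TM} φ(0,α)`. Since `φ(0, ♭_γ X) = (X, ♭_ψ X)`, it is `♯_γ`. -/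
def sharp (x : M) : Cotg E x →L[ℝ] Tg E x :=
  ContinuousLinearMap.fst ℝ (Tg E x) (Cotg E x) ∘L G.φ x ∘L
    ContinuousLinearMap.inr ℝ (Tg E x) (Cotg E x)

/-- The Riemannian metric `γ` of the pair `(γ,ψ)` equivalent to `G`, as the map
`♭_γ : X ↦ γ(X,·)`. -/
def γ (x : M) : Tg E x →L[ℝ] Cotg E x := (G.sharp x).inverse

/-- The 2-form `ψ` of the pair `(γ,ψ)` equivalent to `G`, as the map `♭_ψ : X ↦ ψ(X,·)`. -/
def ψ (x : M) : Tg E x →L[ℝ] Cotg E x :=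
  ContinuousLinearMap.snd ℝ (Tg E x) (Cotg E x) ∘L G.φ x ∘L
    ContinuousLinearMap.inr ℝ (Tg E x) (Cotg E x) ∘L G.γ x

section Lemmas

variable {G} {x : M}

theorem neutral_φ_comm (u v : BigTg E x) :
    neutral (G.φ x u) v = neutral u (G.φ x v) := by
  rw [← G.φ_neutral x u (G.φ x v), G.φ_sq]

theorem sharp_pos {α : Cotg E x} (hα : α ≠ 0) : 0 < α (G.sharp x α) := by
  have := G.pos x (0, α) (by simpa using hα)
  simpa [neutral, sharp] using this

theorem sharp_injective : Function.Injective (G.sharp x) := by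
  refine (injective_iff_map_eq_zero _).2 fun α hα => ?_
  by_contra h
  have := sharp_pos (G := G) h
  simp [hα] at this

variable [FiniteDimensional ℝ E]

theorem sharp_isInvertible : (G.sharp x).IsInvertible := by
  have : FiniteDimensional ℝ (Tg E x) := inferInstanceAs (FiniteDimensional ℝ E)
  have : T2Space (Tg E x) := inferInstanceAs (T2Space E)
  have e1 : Module.finrank ℝ (Cotg E x) = Module.finrank ℝ (Tg E x) := by
    rw [← (LinearMap.toContinuousLinearMap (𝕜 := ℝ) (E := Tg E x) (F' := ℝ)).finrank_eq]
    exact Subspace.dual_finrank_eq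
  have : FiniteDimensional ℝ (Cotg E x) :=
    (LinearMap.toContinuousLinearMap (𝕜 := ℝ) (E := Tg E x) (F' := ℝ)).finiteDimensional
  let e : Cotg E x ≃ₗ[ℝ] Tg E x :=
    LinearEquiv.ofInjectiveOfFinrankEq (G.sharp x).toLinearMap sharp_injective e1
  refine ⟨e.toContinuousLinearEquiv, ?_⟩
  ext α
  rfl

theorem γ_sharp (α : Cotg E x) : G.γ x (G.sharp x α) = α := by
  rw [γ, (sharp_isInvertible (G := G)).inverse_apply_eq]

theorem sharp_γ (X : Tg E x) : G.sharp x (G.γ x X) = X := by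
  have := (sharp_isInvertible (G := G) (x := x)).inverse_apply_eq (y := X)
    (x := G.γ x X)
  exact (this.1 rfl).symm

/-- `♯_γ` is the inverse of `♭_γ`. -/
theorem γ_inverse : (G.γ x).inverse = G.sharp x := by
  refine ContinuousLinearMap.inverse_eq ?_ ?_ <;> ext1 u
  · exact γ_sharp u
  · exact sharp_γ u

theorem φ_zero_γ (X : Tg E x) : G.φ x (0, G.γ x X) = (X, G.ψ x X) := by
  refine Prod.ext ?_ rfl
  exact sharp_γ X

theorem φ_graph (X : Tg E x) : G.φ x (X, G.ψ x X) = (0, G.γ x X) := by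
  rw [← φ_zero_γ, G.φ_sq]

theorem γ_symm (X Y : Tg E x) : G.γ x X Y = G.γ x Y X := by
  have := neutral_φ_comm (G := G) (x := x) (0, G.γ x X) (0, G.γ x Y)
  rw [φ_zero_γ, φ_zero_γ] at this
  simp [neutral] at this
  exact this.symm

theorem γ_pos {X : Tg E x} (hX : X ≠ 0) : 0 < G.γ x X X := by
  have h : G.γ x X ≠ 0 := by
    intro h
    apply hX
    rw [← sharp_γ (G := G) X, h, map_zero]
  simpa [sharp_γ] using sharp_pos (G := G) h

theorem ψ_skew (X Y : Tg E x) : G.ψ x X Y = -G.ψ x Y X := by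
  have := G.φ_neutral x (0, G.γ x X) (0, G.γ x Y)
  rw [φ_zero_γ, φ_zero_γ] at this
  simp [neutral] at this
  linarith

theorem φ_apply (u : BigTg E x) :
    G.φ x u = (G.sharp x (u.2 - G.ψ x u.1),
      G.γ x u.1 + G.ψ x (G.sharp x (u.2 - G.ψ x u.1))) := by
  have key : G.φ x (0, u.2 - G.ψ x u.1)
      = (G.sharp x (u.2 - G.ψ x u.1), G.ψ x (G.sharp x (u.2 - G.ψ x u.1))) := by
    rw [← φ_zero_γ, γ_sharp]
  have hu : u = (u.1, G.ψ x u.1) + (0, u.2 - G.ψ x u.1) := by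
    refine Prod.ext ?_ ?_
    · exact (add_zero _).symm
    · exact (add_sub_cancel _ _).symm
  calc G.φ x u = G.φ x ((u.1, G.ψ x u.1) + (0, u.2 - G.ψ x u.1)) := by rw [← hu]
    _ = G.φ x (u.1, G.ψ x u.1) + G.φ x (0, u.2 - G.ψ x u.1) :=
      ContinuousLinearMap.map_add _ _ _
    _ = _ := by
      rw [φ_graph, key]
      exact Prod.ext (zero_add _) rfl

/-- `V_+` is the set of the vectors `(X, ♭_{ψ+γ}X)`. -/
theorem mem_Vplus_iff (u : BigTg E x) :
    G.φ x u = u ↔ u.2 = G.ψ x u.1 + G.γ x u.1 := by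
  rw [φ_apply]
  constructor
  · intro h
    have h1 : G.sharp x (u.2 - G.ψ x u.1) = u.1 := (Prod.ext_iff.1 h).1
    rw [← sub_eq_iff_eq_add', ← γ_sharp (G := G) (u.2 - G.ψ x u.1), h1]
  · intro h
    have h2 : u.2 - G.ψ x u.1 = G.γ x u.1 := sub_eq_iff_eq_add'.2 h
    rw [h2, sharp_γ]
    exact Prod.ext rfl ((add_comm _ _).trans h.symm)

/-- `V_-` is the set of the vectors `(X, ♭_{ψ-γ}X)`. -/
theorem mem_Vminus_iff (u : BigTg E x) :
    G.φ x u = -u ↔ u.2 = G.ψ x u.1 - G.γ x u.1 := by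
  rw [φ_apply]
  constructor
  · intro h
    have h1 : G.sharp x (u.2 - G.ψ x u.1) = -u.1 := (Prod.ext_iff.1 h).1
    have h2 : u.2 - G.ψ x u.1 = -G.γ x u.1 := by
      rw [← γ_sharp (G := G) (u.2 - G.ψ x u.1), h1, ContinuousLinearMap.map_neg]
    rw [sub_eq_iff_eq_add'.1 h2, sub_eq_add_neg]
  · intro h
    have h2 : u.2 - G.ψ x u.1 = -G.γ x u.1 := by rw [h]; abel
    rw [h2, ContinuousLinearMap.map_neg, sharp_γ, ContinuousLinearMap.map_neg]
    refine Prod.ext rfl ?_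
    change G.γ x u.1 + -G.ψ x u.1 = -u.2
    rw [h]; abel

end Lemmas

variable [FiniteDimensional ℝ E]

/-- The canonical big connection: `∇_X (Y, ♭_{ψ±γ}Y) = (D^±_X Y, ♭_{ψ±γ} D^±_X Y)`, extended
to all sections through the projections `(1/2)(Id ± φ)` onto `V_±`. -/
def canonicalConn (X : Π x : M, Tg E x) (𝒴 : Π x : M, BigTg E x) (x : M) : BigTg E x :=
  let Dp := torsionConn 1 G.γ G.ψ X (fun y => ((1 / 2 : ℝ) • (𝒴 y + G.φ y (𝒴 y))).1) x
  let Dm := torsionConn (-1) G.γ G.ψ X (fun y => ((1 / 2 : ℝ) • (𝒴 y - G.φ y (𝒴 y))).1) x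
  (Dp, G.ψ x Dp + G.γ x Dp) + (Dm, G.ψ x Dm - G.γ x Dm)

/-- `∇_X (Y, ♭_{ψ+γ}Y) = (D^+_X Y, ♭_{ψ+γ} D^+_X Y)`. -/
theorem canonicalConn_plus (X Y : Π x : M, Tg E x) (x : M) :
    G.canonicalConn X (fun y => (Y y, G.ψ y (Y y) + G.γ y (Y y))) x =
      (torsionConn 1 G.γ G.ψ X Y x, G.ψ x (torsionConn 1 G.γ G.ψ X Y x)
        + G.γ x (torsionConn 1 G.γ G.ψ X Y x)) := by
  have h : ∀ y, G.φ y (Y y, G.ψ y (Y y) + G.γ y (Y y)) = (Y y, G.ψ y (Y y) + G.γ y (Y y)) :=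
    fun y => (mem_Vplus_iff _).2 rfl
  have h1 : ∀ y, (1 / 2 : ℝ) • (Y y + Y y) = Y y := fun y => by
    rw [← two_smul ℝ, smul_smul]; norm_num
  simp [canonicalConn, h, torsionConn_zero, -one_div, h1]

/-- `∇_X (Y, ♭_{ψ-γ}Y) = (D^-_X Y, ♭_{ψ-γ} D^-_X Y)`. -/
theorem canonicalConn_minus (X Y : Π x : M, Tg E x) (x : M) :
    G.canonicalConn X (fun y => (Y y, G.ψ y (Y y) - G.γ y (Y y))) x =
      (torsionConn (-1) G.γ G.ψ X Y x, G.ψ x (torsionConn (-1) G.γ G.ψ X Y x)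
        - G.γ x (torsionConn (-1) G.γ G.ψ X Y x)) := by
  have h : ∀ y, G.φ y (Y y, G.ψ y (Y y) - G.γ y (Y y)) = -(Y y, G.ψ y (Y y) - G.γ y (Y y)) :=
    fun y => (mem_Vminus_iff _).2 rfl
  have h1 : ∀ y, (1 / 2 : ℝ) • (Y y + Y y) = Y y := fun y => by
    rw [← two_smul ℝ, smul_smul]; norm_num
  simp [canonicalConn, h, torsionConn_zero, -one_div, h1]
end GenRiemannian

/-- An almost generalized para-Hermitian structure `(G,Ψ)`: a smooth, `g`-skew endomorphism `Ψ`
of `TM ⊕ T*M` with `Ψ² = Id` that is compatible with `G`, i.e. `G(Ψu,Ψv) = G(u,v)`. -/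
structure AlmostParaHermitian (G : GenRiemannian E M) where
  Ψ : Π x : M, BigTg E x →L[ℝ] BigTg E x
  smooth : SmoothBigEnd Ψ
  Ψ_sq : ∀ (x : M) (u : BigTg E x), Ψ x (Ψ x u) = u
  skew : ∀ (x : M) (u v : BigTg E x), neutral u (Ψ x v) + neutral (Ψ x u) v = 0
  compat : ∀ (x : M) (u v : BigTg E x), G.metric x (Ψ x u) (Ψ x v) = G.metric x u v

namespace AlmostParaHermitian

variable {G : GenRiemannian E M} (P : AlmostParaHermitian G)

/-- The endomorphism `F` of `TM` that defines `Ψ`: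
`Ψ(X, ♭_{ψ+γ}X) = (FX, ♭_{ψ-γ}FX)`. -/
def F (x : M) : Tg E x →L[ℝ] Tg E x :=
  ContinuousLinearMap.fst ℝ (Tg E x) (Cotg E x) ∘L P.Ψ x ∘L
    (ContinuousLinearMap.id ℝ (Tg E x)).prod (G.ψ x + G.γ x)

section Lemmas

variable {P} {x : M}

theorem φ_Ψ (u : BigTg E x) : G.φ x (P.Ψ x u) = -P.Ψ x (G.φ x u) := by
  have nondeg : ∀ w : BigTg E x, (∀ v : BigTg E x, neutral w v = 0) → w = 0 := by
    intro w hw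
    by_contra h
    have h1 := G.pos x w h
    rw [GenRiemannian.neutral_φ_comm, hw] at h1
    exact lt_irrefl _ h1
  have hsub : ∀ a b v : BigTg E x, neutral (a + b) v = neutral a v + neutral b v := by
    intro a b v
    simp [neutral]; ring
  rw [eq_neg_iff_add_eq_zero]
  refine nondeg _ fun v => ?_
  have h1 := P.compat x u (P.Ψ x v)
  rw [P.Ψ_sq] at h1
  have h2 := P.skew x (G.φ x u) v
  simp only [GenRiemannian.metric] at h1
  rw [hsub, h1]
  exact h2

variable [FiniteDimensional ℝ E]

theorem Ψ_graph (X : Tg E x) :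
    P.Ψ x (X, G.ψ x X + G.γ x X) = (P.F x X, G.ψ x (P.F x X) - G.γ x (P.F x X)) := by
  have h1 : G.φ x (X, G.ψ x X + G.γ x X) = (X, G.ψ x X + G.γ x X) :=
    (GenRiemannian.mem_Vplus_iff _).2 rfl
  have h2 := φ_Ψ (P := P) (X, G.ψ x X + G.γ x X)
  rw [h1] at h2
  exact Prod.ext rfl ((GenRiemannian.mem_Vminus_iff _).1 h2)

/-- `F` is a `γ`-isometry. -/
theorem F_isometry (X Y : Tg E x) : G.γ x (P.F x X) (P.F x Y) = G.γ x X Y := by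
  have h1 : ∀ Z : Tg E x, G.φ x (Z, G.ψ x Z + G.γ x Z) = (Z, G.ψ x Z + G.γ x Z) :=
    fun Z => (GenRiemannian.mem_Vplus_iff _).2 rfl
  have h2 : ∀ Z : Tg E x, G.φ x (Z, G.ψ x Z - G.γ x Z) = -(Z, G.ψ x Z - G.γ x Z) :=
    fun Z => (GenRiemannian.mem_Vminus_iff _).2 rfl
  have h := P.compat x (X, G.ψ x X + G.γ x X) (Y, G.ψ x Y + G.γ x Y)
  rw [GenRiemannian.metric, GenRiemannian.metric, Ψ_graph, Ψ_graph, h1, h2] at h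
  simp only [neutral, Prod.fst_neg, Prod.snd_neg, neg_apply, map_neg,
    add_apply, sub_apply] at h
  have a1 := GenRiemannian.ψ_skew (G := G) X Y
  have a2 := GenRiemannian.ψ_skew (G := G) (P.F x X) (P.F x Y)
  have a3 := GenRiemannian.γ_symm (G := G) X Y
  have a4 := GenRiemannian.γ_symm (G := G) (P.F x X) (P.F x Y)
  linarith

end Lemmas

variable [FiniteDimensional ℝ E]

/-- `Ψ` is integrable: its Courant-Nijenhuis torsion vanishes. -/
def IsIntegrable : Prop :=
  ∀ 𝒳 𝒴 : Π x : M, BigTg E x, SmoothBigField 𝒳 → SmoothBigField 𝒴 →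
    ∀ x : M, nijenhuis P.Ψ 𝒳 𝒴 x = 0

/-- `Ψ` commutes with the canonical big connection of `G`. -/
def CommutesWithCanonicalConn : Prop :=
  ∀ (X : Π x : M, Tg E x) (𝒴 : Π x : M, BigTg E x), SmoothField X → SmoothBigField 𝒴 →
    ∀ x : M, G.canonicalConn X (fun y => P.Ψ y (𝒴 y)) x = P.Ψ x (G.canonicalConn X 𝒴 x)

/-- `(G,Ψ)` is a parallel generalized para-Hermitian structure. -/
def IsParallel : Prop := P.IsIntegrable ∧ P.CommutesWithCanonicalConn

end AlmostParaHermitian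

variable [FiniteDimensional ℝ E]

/-- The 2-form `ψ` is closed: `dψ = 0`. -/
def IsClosedTwoForm (ψ : Π x : M, Tg E x →L[ℝ] Cotg E x) : Prop :=
  ∀ X Y Z : Π x : M, Tg E x, SmoothField X → SmoothField Y → SmoothField Z →
    ∀ x : M, dTwoForm ψ X Y Z x = 0

/-- The endomorphism `F` of `TM` is parallel with respect to the Levi-Civita connection `D` of
`γ`: `D_X (FY) = F (D_X Y)`. -/
def IsLeviCivitaParallel (γ : Π x : M, Tg E x →L[ℝ] Cotg E x)
    (F : Π x : M, Tg E x →L[ℝ] Tg E x) : Prop :=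
  ∀ X Y : Π x : M, Tg E x, SmoothField X → SmoothField Y →
    ∀ x : M, leviCivita γ X (fun y => F y (Y y)) x = F x (leviCivita γ X Y x)

end Structures

end GeneralizedGeometry

end

/-!
Every section of `TM ⊕ T*M` has components `(X, ♭_{ψ+γ}X)` in `V_+` and `(Y, ♭_{ψ-γ}Y)` in `V_-`.
The Courant torsion of the canonical big connection is `2dψ` on the triples of `V_+`-components plus
`2dψ` on the triples of `V_-`-components. If `Ψ` commutes with a connection, then its
Courant-Nijenhuis torsion is minus a sum of four Courant torsions with `Ψ` inserted in an even
number of slots; so `dψ = 0` makes `Ψ` integrable. Conversely `Ψ` interchanges `V_+` and `V_-`, so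
on three sections of `V_+` only the Courant torsion without `Ψ` survives, and integrability gives
`dψ = 0`. Commuting with `∇` means `D^-F = FD^+`, which for `dψ = 0` reads `DF = FD`.
-/

noncomputable section

namespace GeneralizedGeometry

section BundleSections

variable {𝕜 : Type*} [NontriviallyNormedField 𝕜]
  {EB : Type*} [NormedAddCommGroup EB] [NormedSpace 𝕜 EB]
  {HB : Type*} [TopologicalSpace HB] {I : ModelWithCorners 𝕜 EB HB}
  {B : Type*} [TopologicalSpace B] [ChartedSpace HB B]
  {F₁ F₂ : Type*} [NormedAddCommGroup F₁] [NormedSpace 𝕜 F₁]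
  [NormedAddCommGroup F₂] [NormedSpace 𝕜 F₂] {n : WithTop ℕ∞} {x₀ : B}

theorem contMDiffAt_clm_of_apply [CompleteSpace 𝕜] [FiniteDimensional 𝕜 F₁]
    {A : B → F₁ →L[𝕜] F₂} (h : ∀ v, ContMDiffAt I 𝓘(𝕜, F₂) n (fun x => A x v) x₀) :
    ContMDiffAt I 𝓘(𝕜, F₁ →L[𝕜] F₂) n A x₀ := by
  let b := Module.finBasis 𝕜 F₁
  have hA : A = fun x => ∑ i, ContinuousLinearMap.smulRightL 𝕜 F₁ F₂
      (LinearMap.toContinuousLinearMap (b.coord i)) (A x (b i)) := by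
    funext x
    ext v
    conv_lhs => rw [← b.sum_repr v, map_sum]
    simp
  rw [hA]
  exact ContMDiffAt.sum fun i _ => contMDiffAt_const.clm_apply (h (b i))

variable {V₁ V₂ : B → Type*}
  [TopologicalSpace (TotalSpace F₁ V₁)] [∀ x, TopologicalSpace (V₁ x)] [FiberBundle F₁ V₁]
  [TopologicalSpace (TotalSpace F₂ V₂)] [∀ x, TopologicalSpace (V₂ x)] [FiberBundle F₂ V₂]

theorem contMDiffAt_prod_section_iff [∀ x, Zero (V₁ x)] [∀ x, Zero (V₂ x)]
    {s : Π x : B, V₁ x} {t : Π x : B, V₂ x} :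
    ContMDiffAt I (I.prod 𝓘(𝕜, F₁ × F₂)) n
        (fun x => TotalSpace.mk' (F₁ × F₂) (E := fun x => V₁ x × V₂ x) x (s x, t x)) x₀ ↔
      ContMDiffAt I (I.prod 𝓘(𝕜, F₁)) n (fun x => TotalSpace.mk' F₁ x (s x)) x₀ ∧
      ContMDiffAt I (I.prod 𝓘(𝕜, F₂)) n (fun x => TotalSpace.mk' F₂ x (t x)) x₀ := by
  rw [contMDiffAt_section, contMDiffAt_section, contMDiffAt_section]
  exact contMDiffAt_prod_module_iff _

variable [∀ x, AddCommGroup (V₁ x)] [∀ x, Module 𝕜 (V₁ x)] [VectorBundle 𝕜 F₁ V₁]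
  [∀ x, AddCommGroup (V₂ x)] [∀ x, Module 𝕜 (V₂ x)] [VectorBundle 𝕜 F₂ V₂]

theorem inCoordinates_inverse {x₁ x₂ x : B} (A : V₁ x →L[𝕜] V₂ x)
    (h₁ : x ∈ (trivializationAt F₁ V₁ x₁).baseSet) (h₂ : x ∈ (trivializationAt F₂ V₂ x₂).baseSet) :
    ContinuousLinearMap.inCoordinates F₂ V₂ F₁ V₁ x₂ x x₁ x A.inverse =
      (ContinuousLinearMap.inCoordinates F₁ V₁ F₂ V₂ x₁ x x₂ x A).inverse := by
  rw [ContinuousLinearMap.inCoordinates_eq h₁ h₂, ContinuousLinearMap.inCoordinates_eq h₂ h₁,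
    ContinuousLinearMap.inverse_equiv_comp, ContinuousLinearMap.inverse_comp_equiv,
    ContinuousLinearEquiv.symm_symm, ContinuousLinearMap.comp_assoc]

theorem isInvertible_inCoordinates {x₁ x₂ x : B} {A : V₁ x →L[𝕜] V₂ x} (hA : A.IsInvertible)
    (h₁ : x ∈ (trivializationAt F₁ V₁ x₁).baseSet) (h₂ : x ∈ (trivializationAt F₂ V₂ x₂).baseSet) :
    (ContinuousLinearMap.inCoordinates F₁ V₁ F₂ V₂ x₁ x x₂ x A).IsInvertible := by
  rwa [ContinuousLinearMap.inCoordinates_eq h₁ h₂, ContinuousLinearMap.isInvertible_equiv_comp,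
    ContinuousLinearMap.isInvertible_comp_equiv]

theorem eventually_mem_baseSet_trivializationAt (F : Type*) [TopologicalSpace F] (V : B → Type*)
    [TopologicalSpace (TotalSpace F V)] [∀ x, TopologicalSpace (V x)] [FiberBundle F V] (x₀ : B) :
    ∀ᶠ x in nhds x₀, x ∈ (trivializationAt F V x₀).baseSet :=
  (trivializationAt F V x₀).open_baseSet.mem_nhds (FiberBundle.mem_baseSet_trivializationAt' x₀)

variable [∀ x, IsTopologicalAddGroup (V₂ x)] [∀ x, ContinuousSMul 𝕜 (V₂ x)]

theorem contMDiffAt_hom_of_apply [CompleteSpace 𝕜] [FiniteDimensional 𝕜 F₁]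
    {A : Π x : B, V₁ x →L[𝕜] V₂ x}
    (h : ∀ v : V₁ x₀, ContMDiffAt I (I.prod 𝓘(𝕜, F₂)) n
      (fun x => TotalSpace.mk' F₂ x (A x (FiberBundle.extend F₁ v x))) x₀) :
    ContMDiffAt I (I.prod 𝓘(𝕜, F₁ →L[𝕜] F₂)) n
      (fun x => TotalSpace.mk' (F₁ →L[𝕜] F₂) (E := fun x => V₁ x →L[𝕜] V₂ x) x (A x)) x₀ := by
  rw [contMDiffAt_hom_bundle]
  refine ⟨contMDiffAt_id, contMDiffAt_clm_of_apply fun w => ?_⟩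
  have hw := (contMDiffAt_section _).1 (h ((trivializationAt F₁ V₁ x₀).symm x₀ w))
  refine hw.congr_of_eventuallyEq ?_
  filter_upwards [eventually_mem_baseSet_trivializationAt F₁ V₁ x₀,
    eventually_mem_baseSet_trivializationAt F₂ V₂ x₀] with x hx₁ hx₂
  simp [ContinuousLinearMap.inCoordinates, FiberBundle.extend, hx₂,
    FiberBundle.mem_baseSet_trivializationAt' (F := F₁) (E := V₁) x₀,
    Trivialization.apply_mk_symm, Trivialization.symmL_apply, hx₁]

variable [∀ x, IsTopologicalAddGroup (V₁ x)] [∀ x, ContinuousSMul 𝕜 (V₁ x)]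

theorem contMDiffAt_hom_inverse [CompleteSpace F₁] {A : Π x : B, V₁ x →L[𝕜] V₂ x}
    (hA : ContMDiffAt I (I.prod 𝓘(𝕜, F₁ →L[𝕜] F₂)) n
      (fun x => TotalSpace.mk' (F₁ →L[𝕜] F₂) (E := fun x => V₁ x →L[𝕜] V₂ x) x (A x)) x₀)
    (hinv : (A x₀).IsInvertible) :
    ContMDiffAt I (I.prod 𝓘(𝕜, F₂ →L[𝕜] F₁)) n
      (fun x => TotalSpace.mk' (F₂ →L[𝕜] F₁) (E := fun x => V₂ x →L[𝕜] V₁ x) x (A x).inverse)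
      x₀ := by
  rw [contMDiffAt_hom_bundle] at hA ⊢
  have hd := (isInvertible_inCoordinates (F₁ := F₁) (F₂ := F₂) hinv
    (FiberBundle.mem_baseSet_trivializationAt' x₀)
    (FiberBundle.mem_baseSet_trivializationAt' x₀)).contDiffAt_map_inverse (n := n)
  refine ⟨contMDiffAt_id, (hd.contMDiffAt.comp x₀ hA.2).congr_of_eventuallyEq ?_⟩
  filter_upwards [eventually_mem_baseSet_trivializationAt F₁ V₁ x₀,
    eventually_mem_baseSet_trivializationAt F₂ V₂ x₀] with x hx₁ hx₂
  exact inCoordinates_inverse (A x) hx₁ hx₂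

end BundleSections

theorem exists_contMDiff_section_eq {EB : Type*} [NormedAddCommGroup EB] [NormedSpace ℝ EB]
    [FiniteDimensional ℝ EB] {HB : Type*} [TopologicalSpace HB] {I : ModelWithCorners ℝ EB HB}
    {B : Type*} [TopologicalSpace B] [T2Space B] [ChartedSpace HB B] [IsManifold I ∞ B]
    {F : Type*} [NormedAddCommGroup F] [NormedSpace ℝ F] {V : B → Type*}
    [TopologicalSpace (TotalSpace F V)] [∀ x, TopologicalSpace (V x)] [FiberBundle F V]
    [∀ x, AddCommGroup (V x)] [∀ x, Module ℝ (V x)] [VectorBundle ℝ F V]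
    [ContMDiffVectorBundle ∞ F V I] {x₀ : B} (v : V x₀) :
    ∃ s : Π x : B, V x,
      ContMDiff I (I.prod 𝓘(ℝ, F)) ∞ (fun x => TotalSpace.mk' F x (s x)) ∧ s x₀ = v := by
  obtain ⟨u, hu, hs⟩ := FiberBundle.exists_contMDiffOn_extend (k := ∞) I F v
  obtain ⟨f, hf⟩ := (SmoothBumpFunction.nhds_basis_tsupport (I := I) x₀).mem_iff.1
    (interior_mem_nhds.2 hu)
  refine ⟨fun x => f x • FiberBundle.extend F v x, ?_, by simp⟩
  exact ContMDiffOn.smul_section_of_tsupport f.contMDiff.contMDiffOn isOpen_interior hf.2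
    (hs.mono interior_subset)

section Fields

variable {E : Type*} [NormedAddCommGroup E] [NormedSpace ℝ E]
  {M : Type*} [TopologicalSpace M] [ChartedSpace E M] [IsManifold 𝓘(ℝ, E) ∞ M]

/-- `α` is a smooth 1-form. -/
def SmoothForm (α : Π x : M, Cotg E x) : Prop :=
  ContMDiff 𝓘(ℝ, E) (𝓘(ℝ, E).prod 𝓘(ℝ, E →L[ℝ] ℝ)) ∞
    (fun x => TotalSpace.mk' (E →L[ℝ] ℝ) x (α x))

/-- `B` is a smooth bilinear form on `TM`, written as a map `TM → T*M`. -/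
def SmoothBilinForm (B : Π x : M, Tg E x →L[ℝ] Cotg E x) : Prop :=
  ContMDiff 𝓘(ℝ, E) (𝓘(ℝ, E).prod 𝓘(ℝ, E →L[ℝ] E →L[ℝ] ℝ)) ∞
    (fun x => TotalSpace.mk' (E →L[ℝ] E →L[ℝ] ℝ) (E := fun x => Tg E x →L[ℝ] Cotg E x) x (B x))

/-- The vector field `X` is differentiable at the point `x`. -/
def DiffField (X : Π x : M, Tg E x) (x : M) : Prop :=
  MDiffAt (fun y => TotalSpace.mk' E y (X y)) x

variable {X Y Z : Π x : M, Tg E x} {α β : Π x : M, Cotg E x}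
  {B : Π x : M, Tg E x →L[ℝ] Cotg E x} {𝒳 : Π x : M, BigTg E x} {x : M}

theorem smoothBigField_iff :
    SmoothBigField 𝒳 ↔ SmoothField (fun x => (𝒳 x).1) ∧ SmoothForm (fun x => (𝒳 x).2) := by
  simp only [SmoothBigField, SmoothField, SmoothForm, ContMDiff, ← forall_and]
  exact forall_congr' fun x => contMDiffAt_prod_section_iff (V₁ := fun x => Tg E x)
    (V₂ := fun x => Cotg E x)

theorem SmoothBigField.fst (h : SmoothBigField 𝒳) : SmoothField fun x => (𝒳 x).1 :=
  (smoothBigField_iff.1 h).1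

theorem SmoothBigField.snd (h : SmoothBigField 𝒳) : SmoothForm fun x => (𝒳 x).2 :=
  (smoothBigField_iff.1 h).2

theorem SmoothBigEnd.apply {A : Π x : M, BigTg E x →L[ℝ] BigTg E x} (hA : SmoothBigEnd A)
    (h : SmoothBigField 𝒳) : SmoothBigField (fun x => A x (𝒳 x)) :=
  ContMDiff.clm_bundle_apply (F₁ := E × (E →L[ℝ] ℝ)) (F₂ := E × (E →L[ℝ] ℝ))
    (E₁ := fun x : M => BigTg E x) (E₂ := fun x : M => BigTg E x) hA h

theorem SmoothBilinForm.apply (hB : SmoothBilinForm B) (h : SmoothField X) :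
    SmoothForm (fun x => B x (X x)) :=
  ContMDiff.clm_bundle_apply (F₁ := E) (F₂ := E →L[ℝ] ℝ)
    (E₁ := fun x : M => Tg E x) (E₂ := fun x : M => Cotg E x) hB h

theorem smoothField_zero : SmoothField (0 : Π x : M, Tg E x) := contMDiff_zeroSection ℝ _

theorem SmoothField.add (hX : SmoothField X) (hY : SmoothField Y) : SmoothField (X + Y) :=
  ContMDiff.add_section hX hY

theorem SmoothField.sub (hX : SmoothField X) (hY : SmoothField Y) : SmoothField (X - Y) :=
  ContMDiff.sub_section hX hY

theorem SmoothField.const_smul (c : ℝ) (hX : SmoothField X) : SmoothField (c • X) :=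
  ContMDiff.const_smul_section hX

theorem SmoothForm.add (hα : SmoothForm α) (hβ : SmoothForm β) : SmoothForm (α + β) :=
  ContMDiff.add_section (V := fun x : M => Cotg E x) hα hβ

theorem SmoothField.diffField (hX : SmoothField X) (x : M) : DiffField X x :=
  (hX x).mdifferentiableAt (by simp)

theorem DiffField.add (hX : DiffField X x) (hY : DiffField Y x) : DiffField (X + Y) x :=
  mdifferentiableAt_add_section hX hY

theorem DiffField.sub (hX : DiffField X x) (hY : DiffField Y x) : DiffField (X - Y) x :=
  mdifferentiableAt_sub_section hX hY

theorem SmoothForm.mdifferentiableAt_apply (hα : SmoothForm α) (hX : DiffField X x) :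
    MDiffAt (fun y => α y (X y)) x := by
  have h := MDifferentiableAt.clm_bundle_apply (F₁ := E) (F₂ := ℝ)
    (E₁ := fun x : M => Tg E x) (E₂ := Bundle.Trivial M ℝ)
    ((hα x).mdifferentiableAt (by simp)) hX
  exact ((mdifferentiableAt_totalSpace _ _).1 h).2

theorem SmoothBilinForm.mdifferentiableAt_apply (hB : SmoothBilinForm B) (hX : DiffField X x)
    (hY : DiffField Y x) : MDiffAt (fun y => B y (X y) (Y y)) x := by
  have h := MDifferentiableAt.clm_bundle_apply₂ (F₁ := E) (F₂ := E) (F₃ := ℝ)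
    (E₁ := fun x : M => Tg E x) (E₂ := fun x : M => Tg E x) (E₃ := Bundle.Trivial M ℝ)
    ((hB x).mdifferentiableAt (by simp)) hX hY
  exact ((mdifferentiableAt_totalSpace _ _).1 h).2

end Fields

section FieldCalculus

variable {E : Type*} [NormedAddCommGroup E] [NormedSpace ℝ E]
  {M : Type*} [TopologicalSpace M] [ChartedSpace E M]
  {X Y Z W : Π x : M, Tg E x} {f g : M → ℝ} {x : M}

theorem dirDeriv_add (hf : MDiffAt f x) (hg : MDiffAt g x) :
    dirDeriv X (fun y => f y + g y) x = dirDeriv X f x + dirDeriv X g x :=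
  congrArg (fun L => L (X x)) (mvfderiv_add hf hg)

theorem dirDeriv_sub (hf : MDiffAt f x) (hg : MDiffAt g x) :
    dirDeriv X (fun y => f y - g y) x = dirDeriv X f x - dirDeriv X g x :=
  congrArg (fun L => L (X x)) (mvfderiv_sub hf hg)

theorem dirDeriv_neg : dirDeriv X (fun y => -f y) x = -dirDeriv X f x :=
  congrArg (fun L => L (X x)) (mvfderiv_neg (I := 𝓘(ℝ, E)) (g := f) (x := x))

theorem dirDeriv_mul (hf : MDiffAt f x) (hg : MDiffAt g x) :
    dirDeriv X (fun y => f y * g y) x = f x * dirDeriv X g x + g x * dirDeriv X f x :=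
  congrArg (fun L => L (X x)) (mvfderiv_mul hf hg)

theorem dirDeriv_const (c : ℝ) : dirDeriv X (fun _ => c) x = 0 :=
  congrArg (fun L => L (X x)) (mvfderiv_const (I := 𝓘(ℝ, E)) c)

theorem dirDeriv_zero_left : dirDeriv (0 : Π x : M, Tg E x) f x = 0 :=
  map_zero (mvfderiv 𝓘(ℝ, E) f x)

theorem dirDeriv_add_left : dirDeriv (X + Y) f x = dirDeriv X f x + dirDeriv Y f x :=
  map_add (mvfderiv 𝓘(ℝ, E) f x) (X x) (Y x)

theorem dirDeriv_smul_left : dirDeriv (g • X) f x = g x * dirDeriv X f x :=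
  map_smul (mvfderiv 𝓘(ℝ, E) f x) (g x) (X x)

theorem lie_swap : lie X Y x = -lie Y X x := VectorField.mlieBracket_swap_apply

theorem lie_zero_left : lie 0 X x = 0 :=
  congrFun (VectorField.mlieBracket_zero_left (I := 𝓘(ℝ, E))) x

theorem lie_zero_right : lie X 0 x = 0 :=
  congrFun (VectorField.mlieBracket_zero_right (I := 𝓘(ℝ, E))) x

variable [FiniteDimensional ℝ E] [IsManifold 𝓘(ℝ, E) ∞ M]

theorem lie_add_left (hX : DiffField X x) (hY : DiffField Y x) :
    lie (X + Y) Z x = lie X Z x + lie Y Z x := VectorField.mlieBracket_add_left hX hY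

theorem lie_add_right (hY : DiffField Y x) (hZ : DiffField Z x) :
    lie X (Y + Z) x = lie X Y x + lie X Z x := VectorField.mlieBracket_add_right hY hZ

theorem lie_smul_right (hf : MDiffAt f x) (hY : DiffField Y x) :
    lie X (f • Y) x = dirDeriv X f x • Y x + f x • lie X Y x :=
  VectorField.mlieBracket_smul_right hf hY

theorem tensorialAt_lieDerivForm {μ : Π x : M, Cotg E x} (hμ : SmoothForm μ) :
    TensorialAt 𝓘(ℝ, E) E (fun Z => dirDeriv X (fun y => μ y (Z y)) x - μ x (lie X Z x)) x where
  smul {f Z} hf hZ := by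
    have h := dirDeriv_mul (X := X) hf (hμ.mdifferentiableAt_apply hZ)
    simp only [Pi.smul_apply', map_smul, smul_eq_mul, lie_smul_right hf hZ, map_add] at h ⊢
    rw [h]
    ring
  add {Z W} hZ hW := by
    have h := dirDeriv_add (X := X) (hμ.mdifferentiableAt_apply hZ)
      (hμ.mdifferentiableAt_apply hW)
    simp only [Pi.add_apply, map_add, lie_add_right hZ hW] at h ⊢
    rw [h]
    ring

theorem lieDerivForm_apply {μ : Π x : M, Cotg E x} (hμ : SmoothForm μ) (hZ : DiffField Z x) :
    lieDerivForm X μ x (Z x) = dirDeriv X (fun y => μ y (Z y)) x - μ x (lie X Z x) :=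
  covector_apply (tensorialAt_lieDerivForm hμ) hZ

end FieldCalculus

section TwoForms

variable {E : Type*} [NormedAddCommGroup E] [NormedSpace ℝ E]
  {M : Type*} [TopologicalSpace M] [ChartedSpace E M]
  {ψ : Π x : M, Tg E x →L[ℝ] Cotg E x} {x : M}

theorem dTwoForm_swap_left (hψ : ∀ x v w, ψ x v w = -ψ x w v) (X Y Z : Π x : M, Tg E x) :
    dTwoForm ψ X Y Z x = -dTwoForm ψ Y X Z x := by
  have h : dirDeriv Z (fun y => ψ y (X y) (Y y)) x = -dirDeriv Z (fun y => ψ y (Y y) (X y)) x := by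
    rw [← dirDeriv_neg]
    simp only [← hψ]
  simp only [dTwoForm, h, lie_swap (X := X) (Y := Y), map_neg, neg_apply]
  ring

theorem dTwoForm_swap_right (hψ : ∀ x v w, ψ x v w = -ψ x w v) (X Y Z : Π x : M, Tg E x) :
    dTwoForm ψ X Y Z x = -dTwoForm ψ X Z Y x := by
  have h : dirDeriv X (fun y => ψ y (Y y) (Z y)) x = -dirDeriv X (fun y => ψ y (Z y) (Y y)) x := by
    rw [← dirDeriv_neg]
    simp only [← hψ]
  simp only [dTwoForm, h, lie_swap (X := Z) (Y := Y), map_neg, neg_apply]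
  ring

theorem dTwoForm_rotate (hψ : ∀ x v w, ψ x v w = -ψ x w v) (X Y Z : Π x : M, Tg E x) :
    dTwoForm ψ X Y Z x = dTwoForm ψ Y Z X x := by
  rw [dTwoForm_swap_left hψ X Y Z, dTwoForm_swap_right hψ Y X Z, neg_neg]

theorem dTwoForm_zero_left (X Y : Π x : M, Tg E x) : dTwoForm ψ 0 X Y x = 0 := by
  simp [dTwoForm, lie_zero_left, dirDeriv_zero_left, dirDeriv_const]

theorem dTwoForm_zero_middle (X Y : Π x : M, Tg E x) : dTwoForm ψ X 0 Y x = 0 := by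
  simp [dTwoForm, lie_zero_left, lie_zero_right, dirDeriv_zero_left, dirDeriv_const]

theorem dTwoForm_zero_right (X Y : Π x : M, Tg E x) : dTwoForm ψ X Y 0 x = 0 := by
  simp [dTwoForm, lie_zero_right, dirDeriv_zero_left, dirDeriv_const]

variable [IsManifold 𝓘(ℝ, E) ∞ M]

/-- `ψ` is a smooth 2-form, written as the map `♭_ψ : TM → T*M`. -/
structure IsTwoForm (ψ : Π x : M, Tg E x →L[ℝ] Cotg E x) : Prop where
  smooth : SmoothBilinForm ψ
  skew : ∀ (x : M) (v w : Tg E x), ψ x v w = -ψ x w v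

variable [FiniteDimensional ℝ E] {X Y Z W : Π x : M, Tg E x}

theorem IsTwoForm.tensorialAt_dTwoForm (hψ : IsTwoForm ψ) (hX : DiffField X x)
    (hY : DiffField Y x) : TensorialAt 𝓘(ℝ, E) E (fun Z => dTwoForm ψ X Y Z x) x where
  smul {f Z} hf hZ := by
    have h₁ := dirDeriv_mul (X := X) hf (hψ.smooth.mdifferentiableAt_apply hY hZ)
    have h₂ := dirDeriv_mul (X := Y) hf (hψ.smooth.mdifferentiableAt_apply hX hZ)
    simp only [dTwoForm, Pi.smul_apply', map_smul, smul_eq_mul, lie_smul_right hf hZ, map_add,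
      dirDeriv_smul_left, h₁, h₂, add_apply, smul_apply, hψ.skew x (Z x)]
    ring
  add {Z W} hZ hW := by
    have h₁ := dirDeriv_add (X := X) (hψ.smooth.mdifferentiableAt_apply hY hZ)
      (hψ.smooth.mdifferentiableAt_apply hY hW)
    have h₂ := dirDeriv_add (X := Y) (hψ.smooth.mdifferentiableAt_apply hX hZ)
      (hψ.smooth.mdifferentiableAt_apply hX hW)
    simp only [dTwoForm, Pi.add_apply, map_add, lie_add_right hZ hW, dirDeriv_add_left, h₁, h₂,
      add_apply]
    ring

theorem IsTwoForm.dTwoForm_add_right (hψ : IsTwoForm ψ) (hX : DiffField X x) (hY : DiffField Y x)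
    (hZ : DiffField Z x) (hW : DiffField W x) :
    dTwoForm ψ X Y (Z + W) x = dTwoForm ψ X Y Z x + dTwoForm ψ X Y W x :=
  (hψ.tensorialAt_dTwoForm hX hY).add hZ hW

theorem IsTwoForm.dTwoForm_add_left (hψ : IsTwoForm ψ) (hX : DiffField X x) (hY : DiffField Y x)
    (hZ : DiffField Z x) (hW : DiffField W x) :
    dTwoForm ψ (X + Y) Z W x = dTwoForm ψ X Z W x + dTwoForm ψ Y Z W x := by
  simp only [dTwoForm_rotate hψ.skew _ Z W, hψ.dTwoForm_add_right hZ hW hX hY]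

theorem IsTwoForm.dTwoForm_add_middle (hψ : IsTwoForm ψ) (hX : DiffField X x)
    (hY : DiffField Y x) (hZ : DiffField Z x) (hW : DiffField W x) :
    dTwoForm ψ X (Y + Z) W x = dTwoForm ψ X Y W x + dTwoForm ψ X Z W x := by
  simp only [dTwoForm_rotate hψ.skew X, hψ.dTwoForm_add_left hY hZ hW hX]

-- Grouped by the terms `dψ(X, Yᵢ, Zᵢ)`, which are what `D^±_X Yᵢ` contributes to a Courant torsion.
theorem IsTwoForm.dTwoForm_add_add_add (hψ : IsTwoForm ψ) {X₁ X₂ Y₁ Y₂ Z₁ Z₂ : Π x : M, Tg E x}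
    (hX₁ : DiffField X₁ x) (hX₂ : DiffField X₂ x) (hY₁ : DiffField Y₁ x) (hY₂ : DiffField Y₂ x)
    (hZ₁ : DiffField Z₁ x) (hZ₂ : DiffField Z₂ x) :
    dTwoForm ψ (X₁ + X₂) (Y₁ + Y₂) (Z₁ + Z₂) x =
      dTwoForm ψ (X₁ + X₂) Y₁ Z₁ x + dTwoForm ψ (X₁ + X₂) Y₂ Z₂ x
        - (dTwoForm ψ (Y₁ + Y₂) X₁ Z₁ x + dTwoForm ψ (Y₁ + Y₂) X₂ Z₂ x)
        + (dTwoForm ψ (Z₁ + Z₂) X₁ Y₁ x + dTwoForm ψ (Z₁ + Z₂) X₂ Y₂ x)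
        - 2 * (dTwoForm ψ X₁ Y₁ Z₁ x + dTwoForm ψ X₂ Y₂ Z₂ x) := by
  have hX := hX₁.add hX₂
  have hY := hY₁.add hY₂
  simp only [hψ.dTwoForm_add_right hX hY hZ₁ hZ₂, hψ.dTwoForm_add_middle hX₁ hY₁ hY₂ hZ₁,
    hψ.dTwoForm_add_left, hψ.dTwoForm_add_middle, *]
  simp only [dTwoForm_swap_left hψ.skew Y₁, dTwoForm_swap_left hψ.skew Y₂,
    dTwoForm_rotate hψ.skew Z₁, dTwoForm_rotate hψ.skew Z₂]
  ring

end TwoForms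

section LeviCivita

variable {E : Type*} [NormedAddCommGroup E] [NormedSpace ℝ E]
  {M : Type*} [TopologicalSpace M] [ChartedSpace E M] [IsManifold 𝓘(ℝ, E) ∞ M]

/-- `γ` is a pseudo-Riemannian metric of class `C^∞`, written as the map
`♭_γ : TM → T*M`. -/
structure IsPseudoRiemannian (γ : Π x : M, Tg E x →L[ℝ] Cotg E x) : Prop where
  smooth : SmoothBilinForm γ
  symm : ∀ (x : M) (v w : Tg E x), γ x v w = γ x w v
  isInvertible : ∀ x : M, (γ x).IsInvertible

variable {γ ψ : Π x : M, Tg E x →L[ℝ] Cotg E x} {X Y Z : Π x : M, Tg E x} {x : M}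

namespace IsPseudoRiemannian

theorem ext_of_diffField (hγ : IsPseudoRiemannian γ) {v w : Tg E x}
    (h : ∀ Z, DiffField Z x → γ x v (Z x) = γ x w (Z x)) : v = w := by
  refine (hγ.isInvertible x).injective (ContinuousLinearMap.ext fun z => ?_)
  simpa only [FiberBundle.extend_apply_self] using
    h (FiberBundle.extend E z) (FiberBundle.mdifferentiableAt_extend 𝓘(ℝ, E) E z)

theorem apply_inverse_apply (hγ : IsPseudoRiemannian γ) (α : Cotg E x) :
    γ x ((γ x).inverse α) = α :=
  (hγ.isInvertible x).self_apply_inverse α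

theorem dirDeriv_comm (hγ : IsPseudoRiemannian γ) (X Y Z : Π x : M, Tg E x) :
    dirDeriv X (fun y => γ y (Y y) (Z y)) x = dirDeriv X (fun y => γ y (Z y) (Y y)) x := by
  simp only [hγ.symm _ (Y _)]

variable [FiniteDimensional ℝ E]

theorem tensorialAt_koszul (hγ : IsPseudoRiemannian γ) (hX : DiffField X x) (hY : DiffField Y x) :
    TensorialAt 𝓘(ℝ, E) E (fun Z => koszul γ X Y Z x) x where
  smul {f Z} hf hZ := by
    have h₁ := dirDeriv_mul (X := X) hf (hγ.smooth.mdifferentiableAt_apply hY hZ)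
    have h₂ := dirDeriv_mul (X := Y) hf (hγ.smooth.mdifferentiableAt_apply hX hZ)
    simp only [koszul, Pi.smul_apply', map_smul, smul_eq_mul, lie_smul_right hf hZ, map_add,
      dirDeriv_smul_left, h₁, h₂, add_apply, smul_apply, hγ.symm x (Z x)]
    ring
  add {Z W} hZ hW := by
    have h₁ := dirDeriv_add (X := X) (hγ.smooth.mdifferentiableAt_apply hY hZ)
      (hγ.smooth.mdifferentiableAt_apply hY hW)
    have h₂ := dirDeriv_add (X := Y) (hγ.smooth.mdifferentiableAt_apply hX hZ)
      (hγ.smooth.mdifferentiableAt_apply hX hW)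
    simp only [koszul, Pi.add_apply, map_add, lie_add_right hZ hW, dirDeriv_add_left, h₁, h₂,
      add_apply]
    ring

theorem two_mul_leviCivita (hγ : IsPseudoRiemannian γ) (hX : DiffField X x) (hY : DiffField Y x)
    (hZ : DiffField Z x) : 2 * γ x (leviCivita γ X Y x) (Z x) = koszul γ X Y Z x := by
  rw [leviCivita, hγ.apply_inverse_apply, smul_apply,
    covector_apply (hγ.tensorialAt_koszul hX hY) hZ, smul_eq_mul]
  ring

theorem dirDeriv_eq (hγ : IsPseudoRiemannian γ) (hX : DiffField X x) (hY : DiffField Y x)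
    (hZ : DiffField Z x) : dirDeriv X (fun y => γ y (Y y) (Z y)) x =
      γ x (leviCivita γ X Y x) (Z x) + γ x (leviCivita γ X Z x) (Y x) := by
  have hYZ := hγ.two_mul_leviCivita hX hY hZ
  have hZY := hγ.two_mul_leviCivita hX hZ hY
  simp only [koszul] at hYZ hZY
  rw [hγ.dirDeriv_comm X Z Y, lie_swap (X := Z), map_neg, neg_apply] at hZY
  linarith

theorem leviCivita_sub_swap (hγ : IsPseudoRiemannian γ) (hX : DiffField X x)
    (hY : DiffField Y x) : leviCivita γ X Y x - leviCivita γ Y X x = lie X Y x := by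
  refine hγ.ext_of_diffField fun Z hZ => ?_
  have hXY := hγ.two_mul_leviCivita hX hY hZ
  have hYX := hγ.two_mul_leviCivita hY hX hZ
  simp only [koszul] at hXY hYX
  rw [hγ.dirDeriv_comm Z Y X, lie_swap (X := Y) (Y := X), map_neg, neg_apply] at hYX
  rw [map_sub, sub_apply]
  linarith

theorem leviCivita_add (hγ : IsPseudoRiemannian γ) (hX : DiffField X x) (hY : DiffField Y x)
    (hZ : DiffField Z x) :
    leviCivita γ X (Y + Z) x = leviCivita γ X Y x + leviCivita γ X Z x := by
  refine hγ.ext_of_diffField fun W hW => ?_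
  have hdX := dirDeriv_add (X := X) (hγ.smooth.mdifferentiableAt_apply hY hW)
    (hγ.smooth.mdifferentiableAt_apply hZ hW)
  have hdW := dirDeriv_add (X := W) (hγ.smooth.mdifferentiableAt_apply hX hY)
    (hγ.smooth.mdifferentiableAt_apply hX hZ)
  have hk : koszul γ X (Y + Z) W x = koszul γ X Y W x + koszul γ X Z W x := by
    simp only [koszul, Pi.add_apply, map_add, add_apply, dirDeriv_add_left, hdX, hdW,
      lie_add_left hY hZ, lie_add_right hY hZ]
    ring
  rw [← hγ.two_mul_leviCivita hX (hY.add hZ) hW, ← hγ.two_mul_leviCivita hX hY hW,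
    ← hγ.two_mul_leviCivita hX hZ hW] at hk
  rw [map_add, add_apply]
  linarith

theorem leviCivita_sub (hγ : IsPseudoRiemannian γ) (hX : DiffField X x) (hY : DiffField Y x)
    (hZ : DiffField Z x) :
    leviCivita γ X (Y - Z) x = leviCivita γ X Y x - leviCivita γ X Z x := by
  rw [eq_sub_iff_add_eq, ← hγ.leviCivita_add hX (hY.sub hZ) hZ, sub_add_cancel]

theorem apply_torsionConn (hγ : IsPseudoRiemannian γ) (hψ : IsTwoForm ψ) (s : ℝ)
    (hX : DiffField X x) (hY : DiffField Y x) (hZ : DiffField Z x) :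
    γ x (torsionConn s γ ψ X Y x) (Z x) =
      γ x (leviCivita γ X Y x) (Z x) + s / 2 * dTwoForm ψ X Y Z x := by
  rw [torsionConn, map_add, map_smul, hγ.apply_inverse_apply, add_apply, smul_apply, smul_eq_mul,
    covector_apply (hψ.tensorialAt_dTwoForm hX hY) hZ]

end IsPseudoRiemannian

theorem exists_smoothField_eq [FiniteDimensional ℝ E] [T2Space M] (v : Tg E x) :
    ∃ X : Π x : M, Tg E x, SmoothField X ∧ X x = v :=
  exists_contMDiff_section_eq (V := fun x : M => Tg E x) v

theorem IsPseudoRiemannian.torsionConn_of_isClosed [FiniteDimensional ℝ E] [T2Space M]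
    (hγ : IsPseudoRiemannian γ) (hψ : IsTwoForm ψ) (hψ₀ : IsClosedTwoForm ψ) (s : ℝ)
    (hX : SmoothField X) (hY : SmoothField Y) :
    torsionConn s γ ψ X Y x = leviCivita γ X Y x := by
  refine (hγ.isInvertible x).injective (ContinuousLinearMap.ext fun z => ?_)
  obtain ⟨Z, hZ, rfl⟩ := exists_smoothField_eq z
  rw [hγ.apply_torsionConn hψ s (hX.diffField x) (hY.diffField x) (hZ.diffField x),
    hψ₀ X Y Z hX hY hZ x, mul_zero, add_zero]

end LeviCivita

section CourantBracket

variable {E : Type*} [NormedAddCommGroup E] [NormedSpace ℝ E]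
  {M : Type*} [TopologicalSpace M] [ChartedSpace E M] {x : M}

theorem neutral_add_left (u v w : BigTg E x) : neutral (u + v) w = neutral u w + neutral v w := by
  simp only [neutral, Prod.fst_add, Prod.snd_add, add_apply, map_add]
  ring

theorem neutral_sub_left (u v w : BigTg E x) : neutral (u - v) w = neutral u w - neutral v w := by
  simp only [neutral, Prod.fst_sub, Prod.snd_sub, sub_apply, map_sub]
  ring

/-- The `B`-field transform `(X, α) ↦ (X, ♭_ψ X + α)` of a section of `TM ⊕ T*M`. -/
def bTransform (ψ : Π x : M, Tg E x →L[ℝ] Cotg E x) (𝒳 : Π x : M, BigTg E x) (x : M) :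
    BigTg E x :=
  ((𝒳 x).1, ψ x (𝒳 x).1 + (𝒳 x).2)

variable [IsManifold 𝓘(ℝ, E) ∞ M]
  {γ ψ : Π x : M, Tg E x →L[ℝ] Cotg E x} {X Y Z A B C : Π x : M, Tg E x}
  {𝒳 𝒴 𝒵 : Π x : M, BigTg E x}

theorem SmoothBilinForm.bTransform (hψ : SmoothBilinForm ψ) (h𝒳 : SmoothBigField 𝒳) :
    SmoothBigField (bTransform ψ 𝒳) :=
  smoothBigField_iff.2 ⟨h𝒳.fst, (hψ.apply h𝒳.fst).add h𝒳.snd⟩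

variable [FiniteDimensional ℝ E]

theorem neutral_courant :
    neutral (courant 𝒳 𝒴 x) (𝒵 x) =
      lieDerivForm (fun y => (𝒳 y).1) (fun y => (𝒴 y).2) x (𝒵 x).1
        - lieDerivForm (fun y => (𝒴 y).1) (fun y => (𝒳 y).2) x (𝒵 x).1
        + 1 / 2 * dirDeriv (fun y => (𝒵 y).1) (fun y => (𝒳 y).2 (𝒴 y).1 - (𝒴 y).2 (𝒳 y).1) x
        + (𝒵 x).2 (lie (fun y => (𝒳 y).1) (fun y => (𝒴 y).1) x) :=
  rfl

theorem lieDerivForm_add_apply {α β : Π x : M, Cotg E x} (hα : SmoothForm α) (hβ : SmoothForm β)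
    (hZ : DiffField Z x) :
    lieDerivForm X (fun y => α y + β y) x (Z x) =
      lieDerivForm X α x (Z x) + lieDerivForm X β x (Z x) := by
  have h := dirDeriv_add (X := X) (hα.mdifferentiableAt_apply hZ) (hβ.mdifferentiableAt_apply hZ)
  rw [lieDerivForm_apply hα hZ, lieDerivForm_apply hβ hZ]
  refine (lieDerivForm_apply (hα.add hβ) hZ).trans ?_
  simp only [Pi.add_apply, add_apply, h]
  ring

theorem IsTwoForm.neutral_courant_bTransform (hψ : IsTwoForm ψ) (h𝒳 : SmoothBigField 𝒳)
    (h𝒴 : SmoothBigField 𝒴) (h𝒵 : DiffField (fun y => (𝒵 y).1) x) :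
    neutral (courant (bTransform ψ 𝒳) (bTransform ψ 𝒴) x) (bTransform ψ 𝒵 x) =
      neutral (courant 𝒳 𝒴 x) (𝒵 x)
        + dTwoForm ψ (fun y => (𝒳 y).1) (fun y => (𝒴 y).1) (fun y => (𝒵 y).1) x := by
  have hX := h𝒳.fst.diffField x
  have hY := h𝒴.fst.diffField x
  have hpair : dirDeriv (fun y => (𝒵 y).1) (fun y => (ψ y (𝒳 y).1 + (𝒳 y).2) (𝒴 y).1
        - (ψ y (𝒴 y).1 + (𝒴 y).2) (𝒳 y).1) x =
      2 * dirDeriv (fun y => (𝒵 y).1) (fun y => ψ y (𝒳 y).1 (𝒴 y).1) x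
        + dirDeriv (fun y => (𝒵 y).1) (fun y => (𝒳 y).2 (𝒴 y).1 - (𝒴 y).2 (𝒳 y).1) x := by
    have hdψ := hψ.smooth.mdifferentiableAt_apply hX hY
    rw [two_mul, ← dirDeriv_add hdψ hdψ]
    refine Eq.trans ?_ (dirDeriv_add (hdψ.add hdψ)
      ((h𝒳.snd.mdifferentiableAt_apply hY).sub (h𝒴.snd.mdifferentiableAt_apply hX)))
    congr 1
    funext y
    simp only [add_apply, hψ.skew y (𝒴 y).1]
    ring
  rw [neutral_courant, neutral_courant]
  simp only [bTransform, hpair]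
  simp only [add_apply, dTwoForm,
    lieDerivForm_add_apply (hψ.smooth.apply h𝒴.fst) h𝒴.snd h𝒵,
    lieDerivForm_add_apply (hψ.smooth.apply h𝒳.fst) h𝒳.snd h𝒵,
    lieDerivForm_apply (hψ.smooth.apply h𝒴.fst) h𝒵,
    lieDerivForm_apply (hψ.smooth.apply h𝒳.fst) h𝒵, hψ.skew x (𝒵 x).1, hψ.skew x (𝒴 x).1,
    hψ.skew x (𝒳 x).1]
  ring

theorem IsPseudoRiemannian.lieDerivForm_apply (hγ : IsPseudoRiemannian γ) (hX : DiffField X x)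
    (hA : SmoothField A) (hZ : DiffField Z x) :
    lieDerivForm X (fun y => γ y (A y)) x (Z x) =
      γ x (leviCivita γ X A x) (Z x) + γ x (leviCivita γ Z X x) (A x) := by
  rw [GeneralizedGeometry.lieDerivForm_apply (hγ.smooth.apply hA) hZ,
    hγ.dirDeriv_eq hX (hA.diffField x) hZ, ← hγ.leviCivita_sub_swap hX hZ, map_sub,
    hγ.symm x (A x), hγ.symm x (A x)]
  ring

theorem IsPseudoRiemannian.neutral_courant (hγ : IsPseudoRiemannian γ) (hX : DiffField X x)
    (hY : DiffField Y x) (hZ : DiffField Z x) (hA : SmoothField A) (hB : SmoothField B) :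
    neutral (courant (fun y => (X y, γ y (A y))) (fun y => (Y y, γ y (B y))) x)
        (Z x, γ x (C x)) =
      γ x (leviCivita γ X Y x - leviCivita γ Y X x) (C x)
        + γ x (leviCivita γ X B x - leviCivita γ Y A x) (Z x)
        + 1 / 2 * (γ x (leviCivita γ Z A x) (Y x) - γ x (leviCivita γ Z B x) (X x)
          + γ x (leviCivita γ Z X x) (B x) - γ x (leviCivita γ Z Y x) (A x)) := by
  have hA' := hA.diffField x
  have hB' := hB.diffField x
  rw [GeneralizedGeometry.neutral_courant (𝒵 := fun y => (Z y, γ y (C y)))]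
  simp only [hγ.lieDerivForm_apply hX hB hZ, hγ.lieDerivForm_apply hY hA hZ,
    dirDeriv_sub (hγ.smooth.mdifferentiableAt_apply hA' hY)
      (hγ.smooth.mdifferentiableAt_apply hB' hX),
    hγ.dirDeriv_eq hZ hA' hY, hγ.dirDeriv_eq hZ hB' hX, ← hγ.leviCivita_sub_swap hX hY,
    hγ.symm x (C x), map_sub, sub_apply]
  ring

end CourantBracket

namespace GenRiemannian

variable {E : Type*} [NormedAddCommGroup E] [NormedSpace ℝ E]
  {M : Type*} [TopologicalSpace M] [ChartedSpace E M] [IsManifold 𝓘(ℝ, E) ∞ M]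
  (G : GenRiemannian E M) {x : M}

theorem eq_zero_of_neutral (G : GenRiemannian E M) {u : BigTg E x}
    (h : ∀ v, neutral u v = 0) : u = 0 := by
  by_contra hu
  have hpos := G.pos x u hu
  rw [neutral_φ_comm, h] at hpos
  exact lt_irrefl _ hpos

theorem contMDiffAt_φ_zero {α : Π x : M, Cotg E x}
    (h : ContMDiffAt 𝓘(ℝ, E) (𝓘(ℝ, E).prod 𝓘(ℝ, E →L[ℝ] ℝ)) ∞
      (fun x => TotalSpace.mk' (E →L[ℝ] ℝ) x (α x)) x) :
    ContMDiffAt 𝓘(ℝ, E) (𝓘(ℝ, E).prod 𝓘(ℝ, E × (E →L[ℝ] ℝ))) ∞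
      (fun x => TotalSpace.mk' (E × (E →L[ℝ] ℝ)) (E := fun x => BigTg E x) x (G.φ x (0, α x))) x :=
  ContMDiffAt.clm_bundle_apply (F₁ := E × (E →L[ℝ] ℝ)) (F₂ := E × (E →L[ℝ] ℝ))
    (E₁ := fun x : M => BigTg E x) (E₂ := fun x : M => BigTg E x) (G.smooth x)
    (contMDiffAt_prod_section_iff.2 ⟨smoothField_zero x, h⟩)

/-- The tangent vector `X` for which `(X, ♭_{ψ+γ}X)` is the `V_+`-component of `u`. -/
def plusPart (u : BigTg E x) : Tg E x := ((1 / 2 : ℝ) • (u + G.φ x u)).1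

/-- The tangent vector `X` for which `(X, ♭_{ψ-γ}X)` is the `V_-`-component of `u`. -/
def minusPart (u : BigTg E x) : Tg E x := ((1 / 2 : ℝ) • (u - G.φ x u)).1

/-- The vector of `TM ⊕ T*M` with components `(v, ♭_{ψ+γ}v)` in `V_+` and `(w, ♭_{ψ-γ}w)` in
`V_-`. -/
def ofParts (v w : Tg E x) : BigTg E x := (v + w, G.ψ x (v + w) + G.γ x (v - w))

theorem ofParts_eq_add (v w : Tg E x) :
    G.ofParts v w = (v, G.ψ x v + G.γ x v) + (w, G.ψ x w - G.γ x w) := by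
  refine Prod.ext rfl ?_
  simp only [ofParts, map_add, map_sub, Prod.snd_add]
  abel

variable {𝒳 : Π x : M, BigTg E x}

theorem smoothField_plusPart (h : SmoothBigField 𝒳) : SmoothField fun y => G.plusPart (𝒳 y) :=
  (h.fst.add (G.smooth.apply h).fst).const_smul (1 / 2)

theorem smoothField_minusPart (h : SmoothBigField 𝒳) : SmoothField fun y => G.minusPart (𝒳 y) :=
  (h.fst.sub (G.smooth.apply h).fst).const_smul (1 / 2)

variable [FiniteDimensional ℝ E]

theorem contMDiff_sharp : ContMDiff 𝓘(ℝ, E) (𝓘(ℝ, E).prod 𝓘(ℝ, (E →L[ℝ] ℝ) →L[ℝ] E)) ∞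
    (fun x => TotalSpace.mk' ((E →L[ℝ] ℝ) →L[ℝ] E) (E := fun x => Cotg E x →L[ℝ] Tg E x) x
      (G.sharp x)) := fun _ =>
  contMDiffAt_hom_of_apply (V₁ := fun x : M => Cotg E x) (V₂ := fun x : M => Tg E x) fun α =>
    (contMDiffAt_prod_section_iff.1
      (G.contMDiffAt_φ_zero (FiberBundle.contMDiffAt_extend 𝓘(ℝ, E) (E →L[ℝ] ℝ) α))).1

theorem isPseudoRiemannian_γ : IsPseudoRiemannian G.γ where
  smooth x := contMDiffAt_hom_inverse (V₁ := fun x : M => Cotg E x) (V₂ := fun x : M => Tg E x)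
    (G.contMDiff_sharp x) sharp_isInvertible
  symm _ := γ_symm
  isInvertible _ := (ContinuousLinearMap.isInvertible_inverse_iff).2 sharp_isInvertible

theorem isTwoForm_ψ : IsTwoForm G.ψ where
  smooth x := contMDiffAt_hom_of_apply (V₁ := fun x : M => Tg E x) (V₂ := fun x : M => Cotg E x)
    fun v => (contMDiffAt_prod_section_iff.1 (G.contMDiffAt_φ_zero
      (ContMDiffAt.clm_bundle_apply (F₁ := E) (F₂ := E →L[ℝ] ℝ)
        (E₁ := fun x : M => Tg E x) (E₂ := fun x : M => Cotg E x) (G.isPseudoRiemannian_γ.smooth x)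
        (FiberBundle.contMDiffAt_extend 𝓘(ℝ, E) E v)))).2
  skew _ := ψ_skew

theorem ofParts_plusPart_minusPart (u : BigTg E x) :
    G.ofParts (G.plusPart u) (G.minusPart u) = u := by
  have hadd : G.plusPart u + G.minusPart u = u.1 := by
    simp only [plusPart, minusPart, Prod.smul_fst, Prod.fst_add, Prod.fst_sub]
    module
  have hsub : G.plusPart u - G.minusPart u = (G.φ x u).1 := by
    simp only [plusPart, minusPart, Prod.smul_fst, Prod.fst_add, Prod.fst_sub]
    module
  rw [ofParts, hadd, hsub, φ_apply, γ_sharp, add_sub_cancel]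

theorem fst_φ_ofParts (v w : Tg E x) : (G.φ x (G.ofParts v w)).1 = v - w := by
  simp only [φ_apply, ofParts, add_sub_cancel_left, sharp_γ]

theorem plusPart_ofParts (v w : Tg E x) : G.plusPart (G.ofParts v w) = v := by
  simp only [plusPart, Prod.smul_fst, Prod.fst_add, fst_φ_ofParts]
  simp only [ofParts]
  module

theorem minusPart_ofParts (v w : Tg E x) : G.minusPart (G.ofParts v w) = w := by
  simp only [minusPart, Prod.smul_fst, Prod.fst_sub, fst_φ_ofParts]
  simp only [ofParts]
  module

theorem neutral_ofParts (v w v' w' : Tg E x) :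
    neutral (G.ofParts v w) (G.ofParts v' w') = 2 * (G.γ x v v' - G.γ x w w') := by
  simp only [neutral, ofParts, map_add, map_sub, add_apply, sub_apply, ψ_skew v' v,
    ψ_skew w' v, ψ_skew v' w, ψ_skew w' w, γ_symm v' v, γ_symm w' v, γ_symm v' w, γ_symm w' w]
  ring

theorem canonicalConn_eq_ofParts (X : Π x : M, Tg E x) (𝒴 : Π x : M, BigTg E x) (x : M) :
    G.canonicalConn X 𝒴 x =
      G.ofParts (torsionConn 1 G.γ G.ψ X (fun y => G.plusPart (𝒴 y)) x)
        (torsionConn (-1) G.γ G.ψ X (fun y => G.minusPart (𝒴 y)) x) :=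
  (G.ofParts_eq_add _ _).symm

variable {P Q P₁ Q₁ P₂ Q₂ P₃ Q₃ : Π x : M, Tg E x}

theorem smoothBigField_ofParts (hP : SmoothField P) (hQ : SmoothField Q) :
    SmoothBigField fun y => G.ofParts (P y) (Q y) :=
  G.isTwoForm_ψ.smooth.bTransform (𝒳 := fun y => (P y + Q y, G.γ y (P y - Q y)))
    (smoothBigField_iff.2 ⟨hP.add hQ, G.isPseudoRiemannian_γ.smooth.apply (hP.sub hQ)⟩)

theorem smoothBigField_ofParts_zero (hP : SmoothField P) :
    SmoothBigField fun y => G.ofParts (P y) 0 :=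
  G.smoothBigField_ofParts hP smoothField_zero

theorem neutral_courant_ofParts (hP₁ : SmoothField P₁) (hQ₁ : SmoothField Q₁)
    (hP₂ : SmoothField P₂) (hQ₂ : SmoothField Q₂) (hP₃ : DiffField P₃ x) (hQ₃ : DiffField Q₃ x) :
    neutral (courant (fun y => G.ofParts (P₁ y) (Q₁ y)) (fun y => G.ofParts (P₂ y) (Q₂ y)) x)
        (G.ofParts (P₃ x) (Q₃ x)) =
      2 * G.γ x (leviCivita G.γ (P₁ + Q₁) P₂ x - leviCivita G.γ (P₂ + Q₂) P₁ x) (P₃ x)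
        - 2 * G.γ x (leviCivita G.γ (P₁ + Q₁) Q₂ x - leviCivita G.γ (P₂ + Q₂) Q₁ x) (Q₃ x)
        + (G.γ x (leviCivita G.γ (P₃ + Q₃) P₁ x) (P₂ x)
          - G.γ x (leviCivita G.γ (P₃ + Q₃) P₂ x) (P₁ x))
        - (G.γ x (leviCivita G.γ (P₃ + Q₃) Q₁ x) (Q₂ x)
          - G.γ x (leviCivita G.γ (P₃ + Q₃) Q₂ x) (Q₁ x))
        + dTwoForm G.ψ (P₁ + Q₁) (P₂ + Q₂) (P₃ + Q₃) x := by
  have hγ := G.isPseudoRiemannian_γ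
  have hX := (hP₁.add hQ₁).diffField x
  have hY := (hP₂.add hQ₂).diffField x
  have hZ := hP₃.add hQ₃
  have hbig : ∀ {P Q : Π x : M, Tg E x}, SmoothField P → SmoothField Q →
      SmoothBigField fun y => ((P + Q) y, G.γ y ((P - Q) y)) := fun hP hQ =>
    smoothBigField_iff.2 ⟨hP.add hQ, hγ.smooth.apply (hP.sub hQ)⟩
  refine (G.isTwoForm_ψ.neutral_courant_bTransform (𝒵 := fun y => ((P₃ + Q₃) y,
    G.γ y ((P₃ - Q₃) y))) (hbig hP₁ hQ₁) (hbig hP₂ hQ₂) hZ).trans ?_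
  congr 1
  rw [hγ.neutral_courant hX hY hZ (hP₁.sub hQ₁) (hP₂.sub hQ₂)]
  simp only [hγ.leviCivita_add, hγ.leviCivita_sub, hX, hY, hZ, hP₁.diffField x, hQ₁.diffField x,
    hP₂.diffField x, hQ₂.diffField x, Pi.add_apply, Pi.sub_apply, map_add, map_sub, add_apply,
    sub_apply]
  ring

end GenRiemannian

section CourantTorsion

variable {E : Type*} [NormedAddCommGroup E] [NormedSpace ℝ E]
  {M : Type*} [TopologicalSpace M] [ChartedSpace E M] [IsManifold 𝓘(ℝ, E) ∞ M]
  [FiniteDimensional ℝ E] {x : M}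

/-- The Courant torsion (Gualtieri torsion) of a connection on `TM ⊕ T*M`, evaluated on sections at
the point `x`. The second summand makes it tensorial in all arguments when the connection preserves
the neutral metric. -/
def courantTorsion (conn : (Π x : M, Tg E x) → (Π x : M, BigTg E x) → Π x : M, BigTg E x)
    (𝒳 𝒴 𝒵 : Π x : M, BigTg E x) (x : M) : ℝ :=
  neutral (conn (fun y => (𝒳 y).1) 𝒴 x - conn (fun y => (𝒴 y).1) 𝒳 x - courant 𝒳 𝒴 x) (𝒵 x)
    + 1 / 2 * (neutral (conn (fun y => (𝒵 y).1) 𝒳 x) (𝒴 x)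
      - neutral (conn (fun y => (𝒵 y).1) 𝒴 x) (𝒳 x))

variable {G : GenRiemannian E M} {P₁ Q₁ P₂ Q₂ P₃ Q₃ : Π x : M, Tg E x}
  {𝒳 𝒴 𝒵 : Π x : M, BigTg E x}

theorem GenRiemannian.neutral_canonicalConn_ofParts {X : Π x : M, Tg E x} (hX : DiffField X x)
    (hP₁ : DiffField P₁ x) (hQ₁ : DiffField Q₁ x) (hP₂ : DiffField P₂ x) (hQ₂ : DiffField Q₂ x) :
    neutral (G.canonicalConn X (fun y => G.ofParts (P₁ y) (Q₁ y)) x)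
        (G.ofParts (P₂ x) (Q₂ x)) =
      2 * (G.γ x (leviCivita G.γ X P₁ x) (P₂ x) - G.γ x (leviCivita G.γ X Q₁ x) (Q₂ x))
        + (dTwoForm G.ψ X P₁ P₂ x + dTwoForm G.ψ X Q₁ Q₂ x) := by
  simp only [canonicalConn_eq_ofParts, plusPart_ofParts, minusPart_ofParts, neutral_ofParts]
  rw [G.isPseudoRiemannian_γ.apply_torsionConn G.isTwoForm_ψ 1 hX hP₁ hP₂,
    G.isPseudoRiemannian_γ.apply_torsionConn G.isTwoForm_ψ (-1) hX hQ₁ hQ₂]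
  ring

theorem GenRiemannian.courantTorsion_ofParts (hP₁ : SmoothField P₁) (hQ₁ : SmoothField Q₁)
    (hP₂ : SmoothField P₂) (hQ₂ : SmoothField Q₂) (hP₃ : DiffField P₃ x) (hQ₃ : DiffField Q₃ x) :
    courantTorsion G.canonicalConn (fun y => G.ofParts (P₁ y) (Q₁ y))
        (fun y => G.ofParts (P₂ y) (Q₂ y)) (fun y => G.ofParts (P₃ y) (Q₃ y)) x =
      2 * (dTwoForm G.ψ P₁ P₂ P₃ x + dTwoForm G.ψ Q₁ Q₂ Q₃ x) := by
  have dP₁ := hP₁.diffField x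
  have dQ₁ := hQ₁.diffField x
  have dP₂ := hP₂.diffField x
  have dQ₂ := hQ₂.diffField x
  change neutral (G.canonicalConn (P₁ + Q₁) _ x - G.canonicalConn (P₂ + Q₂) _ x - _) _
    + 1 / 2 * (neutral (G.canonicalConn (P₃ + Q₃) _ x) _
      - neutral (G.canonicalConn (P₃ + Q₃) _ x) _) = _
  rw [neutral_sub_left, neutral_sub_left, neutral_courant_ofParts G hP₁ hQ₁ hP₂ hQ₂ hP₃ hQ₃,
    neutral_canonicalConn_ofParts (dP₁.add dQ₁) dP₂ dQ₂ hP₃ hQ₃,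
    neutral_canonicalConn_ofParts (dP₂.add dQ₂) dP₁ dQ₁ hP₃ hQ₃,
    neutral_canonicalConn_ofParts (hP₃.add hQ₃) dP₁ dQ₁ dP₂ dQ₂,
    neutral_canonicalConn_ofParts (hP₃.add hQ₃) dP₂ dQ₂ dP₁ dQ₁,
    G.isTwoForm_ψ.dTwoForm_add_add_add dP₁ dQ₁ dP₂ dQ₂ hP₃ hQ₃,
    dTwoForm_swap_right G.isTwoForm_ψ.skew (P₃ + Q₃) P₂,
    dTwoForm_swap_right G.isTwoForm_ψ.skew (P₃ + Q₃) Q₂]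
  simp only [map_sub, sub_apply]
  ring

theorem GenRiemannian.courantTorsion_canonicalConn (h𝒳 : SmoothBigField 𝒳)
    (h𝒴 : SmoothBigField 𝒴) (h𝒵 : SmoothBigField 𝒵) :
    courantTorsion G.canonicalConn 𝒳 𝒴 𝒵 x =
      2 * (dTwoForm G.ψ (fun y => G.plusPart (𝒳 y)) (fun y => G.plusPart (𝒴 y))
          (fun y => G.plusPart (𝒵 y)) x
        + dTwoForm G.ψ (fun y => G.minusPart (𝒳 y)) (fun y => G.minusPart (𝒴 y))
          (fun y => G.minusPart (𝒵 y)) x) := by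
  rw [← courantTorsion_ofParts (G.smoothField_plusPart h𝒳) (G.smoothField_minusPart h𝒳)
    (G.smoothField_plusPart h𝒴) (G.smoothField_minusPart h𝒴)
    ((G.smoothField_plusPart h𝒵).diffField x) ((G.smoothField_minusPart h𝒵).diffField x)]
  simp only [ofParts_plusPart_minusPart]

end CourantTorsion

namespace AlmostParaHermitian

variable {E : Type*} [NormedAddCommGroup E] [NormedSpace ℝ E]
  {M : Type*} [TopologicalSpace M] [ChartedSpace E M] [IsManifold 𝓘(ℝ, E) ∞ M]
  {G : GenRiemannian E M} (P : AlmostParaHermitian G) {x : M}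

theorem neutral_Ψ_left (u v : BigTg E x) : neutral (P.Ψ x u) v = -neutral u (P.Ψ x v) :=
  eq_neg_of_add_eq_zero_right (P.skew x u v)

theorem smoothBigField_Ψ {𝒳 : Π x : M, BigTg E x} (h : SmoothBigField 𝒳) :
    SmoothBigField fun y => P.Ψ y (𝒳 y) :=
  P.smooth.apply h

theorem neutral_nijenhuis [FiniteDimensional ℝ E]
    {conn : (Π x : M, Tg E x) → (Π x : M, BigTg E x) → Π x : M, BigTg E x}
    (hconn : ∀ X 𝒴, SmoothField X → SmoothBigField 𝒴 →
      conn X (fun y => P.Ψ y (𝒴 y)) x = P.Ψ x (conn X 𝒴 x))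
    {𝒳 𝒴 𝒵 : Π x : M, BigTg E x} (h𝒳 : SmoothBigField 𝒳) (h𝒴 : SmoothBigField 𝒴)
    (h𝒵 : SmoothBigField 𝒵) :
    neutral (nijenhuis P.Ψ 𝒳 𝒴 x) (𝒵 x) =
      -(courantTorsion conn (fun y => P.Ψ y (𝒳 y)) (fun y => P.Ψ y (𝒴 y)) 𝒵 x
        + courantTorsion conn 𝒳 (fun y => P.Ψ y (𝒴 y)) (fun y => P.Ψ y (𝒵 y)) x
        + courantTorsion conn (fun y => P.Ψ y (𝒳 y)) 𝒴 (fun y => P.Ψ y (𝒵 y)) x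
        + courantTorsion conn 𝒳 𝒴 𝒵 x) := by
  simp only [nijenhuis, courantTorsion, hconn, h𝒳, h𝒴, h𝒳.fst, h𝒴.fst, h𝒵.fst,
    (P.smoothBigField_Ψ h𝒳).fst, (P.smoothBigField_Ψ h𝒴).fst, (P.smoothBigField_Ψ h𝒵).fst,
    neutral_add_left, neutral_sub_left, P.Ψ_sq, neutral_Ψ_left]
  ring

end AlmostParaHermitian

namespace AlmostParaHermitian

variable {E : Type*} [NormedAddCommGroup E] [NormedSpace ℝ E] [FiniteDimensional ℝ E]
  {M : Type*} [TopologicalSpace M] [ChartedSpace E M] [IsManifold 𝓘(ℝ, E) ∞ M]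
  {G : GenRiemannian E M} {P : AlmostParaHermitian G} {x : M}

theorem Ψ_ofParts (v w : Tg E x) : P.Ψ x (G.ofParts v (P.F x w)) = G.ofParts w (P.F x v) := by
  rw [G.ofParts_eq_add, ContinuousLinearMap.map_add, Ψ_graph, ← Ψ_graph w, P.Ψ_sq,
    G.ofParts_eq_add, add_comm]

theorem Ψ_ofParts_zero (v : Tg E x) : P.Ψ x (G.ofParts v 0) = G.ofParts 0 (P.F x v) := by
  simpa only [map_zero] using Ψ_ofParts (P := P) v 0

theorem minusPart_Ψ (u : BigTg E x) : G.minusPart (P.Ψ x u) = P.F x (G.plusPart u) := by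
  have hV : G.φ x ((1 / 2 : ℝ) • (u + G.φ x u)) = (1 / 2 : ℝ) • (u + G.φ x u) := by
    rw [ContinuousLinearMap.map_smul, ContinuousLinearMap.map_add, G.φ_sq, add_comm]
  have hgraph : (1 / 2 : ℝ) • (u + G.φ x u)
      = (G.plusPart u, G.ψ x (G.plusPart u) + G.γ x (G.plusPart u)) :=
    Prod.ext rfl ((GenRiemannian.mem_Vplus_iff _).1 hV)
  rw [GenRiemannian.minusPart, φ_Ψ, sub_neg_eq_add,
    ← ContinuousLinearMap.map_add, ← ContinuousLinearMap.map_smul, hgraph, Ψ_graph]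

theorem smoothField_F {Y : Π x : M, Tg E x} (hY : SmoothField Y) :
    SmoothField fun y => P.F y (Y y) := by
  have h := G.smoothField_minusPart (P.smoothBigField_Ψ (G.smoothBigField_ofParts_zero hY))
  simpa only [minusPart_Ψ, GenRiemannian.plusPart_ofParts] using h

theorem commutesWithCanonicalConn_iff :
    P.CommutesWithCanonicalConn ↔ ∀ X Y : Π x : M, Tg E x, SmoothField X → SmoothField Y →
      ∀ x : M, torsionConn (-1) G.γ G.ψ X (fun y => P.F y (Y y)) x
        = P.F x (torsionConn 1 G.γ G.ψ X Y x) := by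
  refine ⟨fun hC X Y hX hY x => ?_, fun hF X 𝒴 hX h𝒴 x => ?_⟩
  · have h := congrArg G.minusPart
      (hC X (fun y => G.ofParts (Y y) 0) hX (G.smoothBigField_ofParts_zero hY) x)
    simpa only [minusPart_Ψ, G.canonicalConn_eq_ofParts, G.minusPart_ofParts,
      G.plusPart_ofParts] using h
  · have hΨ𝒴 := P.smoothBigField_Ψ h𝒴
    have hminus : (fun y => G.minusPart (𝒴 y)) = fun y => P.F y (G.plusPart (P.Ψ y (𝒴 y))) := by
      simp only [← minusPart_Ψ, P.Ψ_sq]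
    simp only [G.canonicalConn_eq_ofParts, hminus, minusPart_Ψ,
      hF X _ hX (G.smoothField_plusPart h𝒴), hF X _ hX (G.smoothField_plusPart hΨ𝒴), Ψ_ofParts]

variable (P) in
theorem commutesWithCanonicalConn_iff_of_isClosed [T2Space M] (hψ : IsClosedTwoForm G.ψ) :
    P.CommutesWithCanonicalConn ↔ IsLeviCivitaParallel G.γ P.F := by
  rw [commutesWithCanonicalConn_iff]
  refine forall₄_congr fun X Y hX hY => forall_congr' fun x => ?_
  rw [G.isPseudoRiemannian_γ.torsionConn_of_isClosed G.isTwoForm_ψ hψ _ hX (smoothField_F hY),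
    G.isPseudoRiemannian_γ.torsionConn_of_isClosed G.isTwoForm_ψ hψ _ hX hY]

theorem CommutesWithCanonicalConn.isIntegrable_of_isClosed [T2Space M]
    (hC : P.CommutesWithCanonicalConn) (hψ : IsClosedTwoForm G.ψ) : P.IsIntegrable := by
  intro 𝒳 𝒴 h𝒳 h𝒴 x
  refine G.eq_zero_of_neutral fun w => ?_
  obtain ⟨𝒵, h𝒵, rfl⟩ : ∃ 𝒵 : Π x : M, BigTg E x, SmoothBigField 𝒵 ∧ 𝒵 x = w :=
    exists_contMDiff_section_eq (V := fun x : M => BigTg E x) w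
  have hT : ∀ {𝒳 𝒴 𝒵 : Π x : M, BigTg E x}, SmoothBigField 𝒳 → SmoothBigField 𝒴 →
      SmoothBigField 𝒵 → courantTorsion G.canonicalConn 𝒳 𝒴 𝒵 x = 0 := fun h𝒳 h𝒴 h𝒵 => by
    rw [GenRiemannian.courantTorsion_canonicalConn h𝒳 h𝒴 h𝒵,
      hψ _ _ _ (G.smoothField_plusPart h𝒳) (G.smoothField_plusPart h𝒴) (G.smoothField_plusPart h𝒵),
      hψ _ _ _ (G.smoothField_minusPart h𝒳) (G.smoothField_minusPart h𝒴)
        (G.smoothField_minusPart h𝒵), add_zero, mul_zero]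
  have hΨ𝒳 := P.smoothBigField_Ψ h𝒳
  have hΨ𝒴 := P.smoothBigField_Ψ h𝒴
  have hΨ𝒵 := P.smoothBigField_Ψ h𝒵
  simp only [P.neutral_nijenhuis (fun X 𝒴 hX h𝒴 => hC X 𝒴 hX h𝒴 x) h𝒳 h𝒴 h𝒵, hT, h𝒳, h𝒴, h𝒵,
    hΨ𝒳, hΨ𝒴, hΨ𝒵, add_zero, neg_zero]

theorem CommutesWithCanonicalConn.neutral_nijenhuis_ofParts_zero
    (hC : P.CommutesWithCanonicalConn) {X Y Z : Π x : M, Tg E x} (hX : SmoothField X)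
    (hY : SmoothField Y) (hZ : SmoothField Z) :
    neutral (nijenhuis P.Ψ (fun y => G.ofParts (X y) 0) (fun y => G.ofParts (Y y) 0) x)
      (G.ofParts (Z x) 0) = -2 * dTwoForm G.ψ X Y Z x := by
  have h𝒳 := G.smoothBigField_ofParts_zero hX
  have h𝒴 := G.smoothBigField_ofParts_zero hY
  have h𝒵 := G.smoothBigField_ofParts_zero hZ
  rw [P.neutral_nijenhuis (fun X 𝒴 hX h𝒴 => hC X 𝒴 hX h𝒴 x) h𝒳 h𝒴 h𝒵]
  simp only [GenRiemannian.courantTorsion_canonicalConn, h𝒳, h𝒴, h𝒵, P.smoothBigField_Ψ h𝒳,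
    P.smoothBigField_Ψ h𝒴, P.smoothBigField_Ψ h𝒵]
  simp only [Ψ_ofParts_zero, GenRiemannian.plusPart_ofParts, GenRiemannian.minusPart_ofParts,
    ← Pi.zero_def, dTwoForm_zero_left, dTwoForm_zero_middle, dTwoForm_zero_right]
  ring

theorem CommutesWithCanonicalConn.isIntegrable_iff [T2Space M]
    (hC : P.CommutesWithCanonicalConn) : P.IsIntegrable ↔ IsClosedTwoForm G.ψ := by
  refine ⟨fun hI X Y Z hX hY hZ x => ?_, hC.isIntegrable_of_isClosed⟩
  have h := hC.neutral_nijenhuis_ofParts_zero (x := x) hX hY hZ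
  rw [hI _ _ (G.smoothBigField_ofParts_zero hX) (G.smoothBigField_ofParts_zero hY)] at h
  simpa [neutral] using h

end AlmostParaHermitian

end GeneralizedGeometry

end

theorem proposition3p3 {E : Type*} [NormedAddCommGroup E] [NormedSpace ℝ E]
    [FiniteDimensional ℝ E] {M : Type*} [TopologicalSpace M] [T2Space M] [ChartedSpace E M]
    [IsManifold 𝓘(ℝ, E) ∞ M] (G : GeneralizedGeometry.GenRiemannian E M)
    (P : GeneralizedGeometry.AlmostParaHermitian G) :
    P.IsParallel ↔ GeneralizedGeometry.IsClosedTwoForm G.ψ ∧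
      GeneralizedGeometry.IsLeviCivitaParallel G.γ P.F := by
  constructor
  · rintro ⟨hI, hC⟩
    have hψ := hC.isIntegrable_iff.1 hI
    exact ⟨hψ, (P.commutesWithCanonicalConn_iff_of_isClosed hψ).1 hC⟩
  · rintro ⟨hψ, hF⟩
    have hC := (P.commutesWithCanonicalConn_iff_of_isClosed hψ).2 hF
    exact ⟨hC.isIntegrable_iff.2 hψ, hC⟩
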